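/- C*-algebras are complex and not necessarily unital, and homomorphisms between them are $*$-homomorphisms. An NC $*$-polynomial in $x_1,\dots,x_r$ is an element $p$ of the free complex algebra on the letters $x_1,\dots,x_r,x_1^*,\dots,x_r^*$; it is homogeneous of degree $d$ if $p(tx_1,\dots,tx_r)=t^d\,p(x_1,\dots,x_r)$ for all real scalars $t$. **Theorem.** Let $r,J\ge 0$ be integers and let $2<q<\infty$. Let $p_1,\dots,p_J$ be NC $*$-polynomials in $x_1,\dots,x_r$, where $p_j$ is homogeneous of degree $d_j\ge 1$, and let $C_1,\dots,C_J>0$ be real constants. Then the universal C*-algebra $$P=C^*\Big\langle x_1,\dots,x_r\ \Big|\ \Big\|\sum_{k=1}^r (x_kx_k^*)^{q/2}\Big\|\le 1,\quad \|p_j(x_1,\dots,x_r)\|\le C_j\ \ (j=1,\dots,J)\Big\rangle$$ exists and is projective. Here universality means that the generators $x_1,\dots,x_r$ of $P$ satisfy these relations and that for all elements $y_1,\dots,y_r$ of a C*-algebra $B$ that satisfy them there is exactly one $*$-homomorphism $P\to B$ with $x_k\mapsto y_k$ for all $k$. Projectivity means that for every surjective $*$-homomorphism $\rho:B\to C$ of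 C*-algebras and every $*$-homomorphism $\varphi:P\to C$ there is a $*$-homomorphism $\psi:P\to B$ with $\rho\circ\psi=\varphi$. -/

import Mathlib

universe u

/-- Noncommutative `*`-polynomials with complex coefficients in `x₁, …, x_r`: the free associative
`ℂ`-algebra on the `2r` letters `x₁, …, x_r` (`Sum.inl k`) and `x₁*, …, x_r*` (`Sum.inr k`). -/
abbrev NCStarPoly (r : ℕ) : Type :=
  FreeAlgebra ℂ (Fin r ⊕ Fin r)

namespace NCStarPoly

/-- The substitution `p(x) ↦ p(tx)` for a real scalar `t` (note `(t x)* = t x*`). -/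
noncomputable def scale {r : ℕ} (t : ℝ) : NCStarPoly r →ₐ[ℂ] NCStarPoly r :=
  FreeAlgebra.lift ℂ fun i => (t : ℂ) • FreeAlgebra.ι ℂ i

/-- `p` is homogeneous of degree `d`: `p(tx) = t ^ d p(x)` for all real scalars `t`. -/
def IsHomogeneous {r : ℕ} (p : NCStarPoly r) (d : ℕ) : Prop :=
  ∀ t : ℝ, scale t p = (t : ℂ) ^ d • p

/-- The value `p(x)` at a tuple `x` in a (not necessarily unital) C*-algebra `A`. A constant term
is evaluated through the unit of the unitization of `A`; a polynomial without constant term takes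
its values in the copy of `A` that lies isometrically in the unitization. -/
noncomputable def eval {r : ℕ} {A : Type u} [NonUnitalCStarAlgebra A] (x : Fin r → A) :
    NCStarPoly r →ₐ[ℂ] Unitization ℂ A :=
  FreeAlgebra.lift ℂ
    (Sum.elim (fun k => (x k : Unitization ℂ A)) fun k => ((star (x k) : A) : Unitization ℂ A))

end NCStarPoly

/-- The relations `‖∑ₖ (xₖ xₖ*)^(q/2)‖ ≤ 1` and `‖pⱼ(x₁, …, x_r)‖ ≤ Cⱼ` on a tuple `x` in a
C*-algebra; the power of the positive element `xₖ xₖ*` is that of the continuous functional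
calculus. -/
structure NCBallRelations {r J : ℕ} (q : ℝ) (p : Fin J → NCStarPoly r) (C : Fin J → ℝ)
    (A : Type u) [NonUnitalCStarAlgebra A] (x : Fin r → A) : Prop where
  ball : ‖∑ k, cfcₙ (fun t : ℝ => t ^ (q / 2)) (x k * star (x k))‖ ≤ 1
  poly : ∀ j, ‖NCStarPoly.eval x (p j)‖ ≤ C j

/-- `(P, x)` is the universal C*-algebra `C*⟨x₁, …, x_r | R⟩`: the tuple `x` in `P` satisfies the
relations `R`, and for every tuple `y` satisfying `R` in a C*-algebra `B` there is exactly one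
`*`-homomorphism `P → B` with `xₖ ↦ yₖ`. -/
structure IsUniversalCStarAlgebra {r : ℕ}
    (R : ∀ (A : Type u) [NonUnitalCStarAlgebra A], (Fin r → A) → Prop)
    (P : Type u) [NonUnitalCStarAlgebra P] (x : Fin r → P) : Prop where
  rel : R P x
  existsUnique_hom : ∀ (B : Type u) [NonUnitalCStarAlgebra B] (y : Fin r → B), R B y →
    ∃! φ : P →⋆ₙₐ[ℂ] B, ∀ k, φ (x k) = y k

/-- A C*-algebra `P` is projective if `ρ ∘ - : hom(P, B) → hom(P, C)` is onto whenever
`ρ : B → C` is a surjective `*`-homomorphism of C*-algebras. -/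
def IsProjectiveCStarAlgebra (P : Type u) [NonUnitalCStarAlgebra P] : Prop :=
  ∀ (B C : Type u) [NonUnitalCStarAlgebra B] [NonUnitalCStarAlgebra C] (ρ : B →⋆ₙₐ[ℂ] C),
    Function.Surjective ρ →
      Function.Surjective fun ψ : P →⋆ₙₐ[ℂ] B => ρ.comp ψ

open Filter Topology

/-! Projectivity amounts to lifting tuples: given `ρ : B → D` onto and `y` in `D` satisfying the
relations, find a preimage tuple that satisfies the same relations exactly. After unitization, start
from any preimage `x`; it satisfies the relations up to a factor governed by some `ε`. Take `u` far
out in a quasicentral approximate unit of `ker ρ` and replace `x` by `h x`, where `h = 1 - c u` and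
`(1 + ε)(1 - c) = 1`. Since `ρ h = 1`, this is still a lift. Along `ker ρ` the factor `h` acts
almost as `1 - c` and cancels the excess `1 + ε`; modulo `ker ρ` the bounds hold already. So the new
tuple satisfies the relations up to any prescribed `ε' > 0`, at distance at most `ε ‖x‖`. With `ε /
2 ^ n` at stage `n` the tuples converge to an exact lift (`RelaxedRelations.exists_lift`).

Three estimates justify one step: the norm of `h T h` comes down to that of `ρ T`
(`IsQuasicentralFilter.eventually_norm_conj_le`); `p (h x)` is close to `h ^ d p(x)` for homogeneous
`p` (`NCStarPoly.IsHomogeneous.tendsto_aeval`); and `(h X h) ^ s ≤ h X ^ s h` up to a small error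
for `s = q / 2 ≥ 1` (`asympLE_conj_rpow`), although `t ^ s` is not operator monotone for `s > 1`.

The universal algebra is generated by the diagonal tuple in an `ℓ^∞`-product of representations. The
ball relation bounds the generators, and homogeneity of positive degree removes constant terms, so
the relations pass to products. -/

theorem StarAlgHom.continuous_of_cstarAlgebra {A D : Type*} [CStarAlgebra A] [CStarAlgebra D]
    (ρ : A →⋆ₐ[ℂ] D) : Continuous ρ :=
  AddMonoidHomClass.continuous_of_bound ρ 1 fun a => by
    simpa using NonUnitalStarAlgHom.norm_apply_le ρ a

theorem StarAlgHom.map_real_smul_eq_zero {A D : Type*} [CStarAlgebra A] [CStarAlgebra D]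
    (ρ : A →⋆ₐ[ℂ] D) (c : ℝ) {z : A} (hz : ρ z = 0) : ρ (c • z) = 0 := by
  have := map_smul ρ (c : ℂ) z
  rwa [hz, smul_zero, Complex.coe_smul] at this

/-- The commutator lies in `ker ρ`, where `φ` is nearly `φ (e * ·)`. Multiplication by `e` moves
everything into the ideal: `e a` and `e` are nearly fixed by `u` on the right, so `e (u a - a u)` is
small. -/
theorem functional_commutator_le {A D : Type*} [CStarAlgebra A] [CStarAlgebra D]
    (ρ : A →⋆ₐ[ℂ] D) (φ : A →L[ℝ] ℝ) {a e u : A} {δ : ℝ}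
    (hun : ‖u‖ ≤ 1) (hρu : ρ u = 0) (he : ∀ x, ρ x = 0 → |φ x - φ (e * x)| ≤ δ * ‖x‖)
    (h5 : ‖e * a - e * a * u‖ ≤ δ) (h6 : ‖e - e * u‖ ≤ δ) :
    φ (u * a - a * u) ≤ δ * (2 * ‖a‖ + ‖φ‖ * (‖a‖ + 1)) := by
  have hδ : 0 ≤ δ := (norm_nonneg _).trans h6
  have h1 := he (u * a - a * u) (by simp [hρu])
  have h2 : ‖u * a - a * u‖ ≤ 2 * ‖a‖ := by
    refine (norm_sub_le _ _).trans ?_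
    have h3 := norm_mul_le u a
    have h4 := norm_mul_le a u
    nlinarith [norm_nonneg a]
  have h3 : ‖e * (u * a - a * u)‖ ≤ δ * (‖a‖ + 1) := by
    have h4 : e * (u * a - a * u) = (e * a - e * a * u) - (e - e * u) * a := by
      noncomm_ring
    rw [h4]
    refine (norm_sub_le _ _).trans ?_
    have h7 := norm_mul_le (e - e * u) a
    nlinarith [norm_nonneg a]
  have h8 : φ (e * (u * a - a * u)) ≤ ‖φ‖ * (δ * (‖a‖ + 1)) :=
    (Real.le_norm_self _).trans ((φ.le_opNorm _).trans (by gcongr))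
  have h9 := (abs_le.1 h1).2
  have h10 : δ * ‖u * a - a * u‖ ≤ δ * (2 * ‖a‖) := by gcongr
  linarith

/-! ### Quasicentral approximate units for the kernel of a `*`-homomorphism. -/

section Quasicentral

variable {A D : Type*} [CStarAlgebra A] [PartialOrder A] [StarOrderedRing A] [CStarAlgebra D]

theorem norm_sub_mul_self_sq_le (B b u : A) (hu : IsSelfAdjoint u) (hb : b * star b ≤ B) :
    ‖b - u * b‖ ^ 2 ≤ ‖(1 - u) * B * (1 - u)‖ := by
  have h1 : ‖b - u * b‖ ^ 2 = ‖(1 - u) * (b * star b) * (1 - u)‖ := by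
    rw [sq, ← CStarRing.norm_self_mul_star]
    congr 1
    simp only [star_sub, star_mul, hu.star_eq]
    noncomm_ring
  have hs : star (1 - u) = 1 - u := by simp [hu.star_eq]
  rw [h1]
  have h2 := star_left_conjugate_le_conjugate hb (1 - u)
  have h3 := star_left_conjugate_nonneg (mul_star_self_nonneg b) (1 - u)
  rw [hs] at h2 h3
  exact CStarAlgebra.norm_le_norm_of_nonneg_of_le h3 h2

theorem exists_approx_unit_of_nonneg (ρ : A →⋆ₐ[ℂ] D) {B : A} (hB : 0 ≤ B) (hρ : ρ B = 0)
    {δ : ℝ} (hδ : 0 < δ) :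
    ∃ u : A, 0 ≤ u ∧ u ≤ 1 ∧ ρ u = 0 ∧ ‖(1 - u) * B * (1 - u)‖ ≤ δ := by
  have hsa : IsSelfAdjoint B := .of_nonneg hB
  have hc : Continuous fun t : ℝ => min 1 (t / δ) := by fun_prop
  -- The function vanishes at `0`, which puts `u` in the kernel. It equals `1` beyond `δ`, so `(1 -
  -- u) B (1 - u)` only sees spectrum in `[0, δ]`.
  refine ⟨cfc (fun t : ℝ => min 1 (t / δ)) B, ?_, ?_, ?_, ?_⟩
  · refine cfc_nonneg fun t ht => ?_
    have := spectrum_nonneg_of_nonneg hB ht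
    positivity
  · exact cfc_le_one _ _ fun t ht => min_le_left _ _
  · rw [StarAlgHomClass.map_cfc ρ _ B hc.continuousOn ρ.continuous_of_cstarAlgebra hsa
      (by rw [hρ]; exact .zero _), hρ, cfc_apply_zero]
    simp
  · have h1 : (1 - cfc (fun t : ℝ => min 1 (t / δ)) B) * B *
        (1 - cfc (fun t : ℝ => min 1 (t / δ)) B)
        = cfc (fun t : ℝ => (1 - min 1 (t / δ)) * t * (1 - min 1 (t / δ))) B := by
      rw [cfc_mul (fun t : ℝ => (1 - min 1 (t / δ)) * t) (fun t : ℝ => 1 - min 1 (t / δ)) B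
        (by fun_prop) (by fun_prop), cfc_mul (fun t : ℝ => 1 - min 1 (t / δ)) (fun t : ℝ => t) B
        (by fun_prop) (by fun_prop), cfc_sub (fun _ : ℝ => 1) (fun t : ℝ => min 1 (t / δ)) B
        (by fun_prop) (by fun_prop), cfc_const_one ℝ B, cfc_id' ℝ B]
    rw [h1]
    refine norm_cfc_le hδ.le fun t ht => ?_
    have ht0 := spectrum_nonneg_of_nonneg hB ht
    have h0 : 0 ≤ t / δ := by positivity
    rw [Real.norm_eq_abs, abs_le]
    rcases le_total 1 (t / δ) with h | h
    · rw [min_eq_left h]; constructor <;> nlinarith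
    · rw [min_eq_right h]
      have h2 : t ≤ δ := by rwa [div_le_one hδ] at h
      have h3 : 0 ≤ 1 - t / δ := by linarith
      have h4 : 1 - t / δ ≤ 1 := by linarith
      constructor
      · have : 0 ≤ (1 - t / δ) * t * (1 - t / δ) := by positivity
        linarith
      · calc (1 - t / δ) * t * (1 - t / δ) ≤ 1 * t * 1 := by gcongr
          _ ≤ δ := by linarith

theorem exists_approx_unit_ker (ρ : A →⋆ₐ[ℂ] D) (s : Finset A) {ε : ℝ} (hε : 0 < ε) :
    ∃ u : A, 0 ≤ u ∧ u ≤ 1 ∧ ρ u = 0 ∧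
      ∀ b ∈ s, ρ b = 0 → ‖b - u * b‖ ≤ ε ∧ ‖b - b * u‖ ≤ ε := by
  classical
  set t := s.filter fun b => ρ b = 0
  -- One positive element dominating every `b b*` and `b* b` controls left and right multiplication
  -- for the whole finite set; norms get squared, hence `ε ^ 2` below.
  set B := ∑ b ∈ t, (b * star b + star b * b) with hBdef
  have hpos : ∀ b : A, 0 ≤ b * star b + star b * b := fun b =>
    add_nonneg (mul_star_self_nonneg b) (star_mul_self_nonneg b)
  have hB : 0 ≤ B := Finset.sum_nonneg fun b _ => hpos b
  have hρB : ρ B = 0 := by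
    rw [hBdef, map_sum]
    refine Finset.sum_eq_zero fun b hb => ?_
    have : ρ b = 0 := (Finset.mem_filter.1 hb).2
    simp [this]
  obtain ⟨u, hu0, hu1, hρu, hu⟩ := exists_approx_unit_of_nonneg ρ hB hρB (sq_pos_of_pos hε)
  have husa : IsSelfAdjoint u := .of_nonneg hu0
  refine ⟨u, hu0, hu1, hρu, fun b hb hρb => ?_⟩
  have hle : b * star b + star b * b ≤ B :=
    Finset.single_le_sum (f := fun b : A => b * star b + star b * b) (fun b _ => hpos b)
      (Finset.mem_filter.2 ⟨hb, hρb⟩)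
  constructor
  · have := norm_sub_mul_self_sq_le B b u husa
      (le_trans (le_add_of_nonneg_right (star_mul_self_nonneg b)) hle)
    exact (abs_le_of_sq_le_sq' (this.trans hu) hε.le).2
  · have := norm_sub_mul_self_sq_le B (star b) u husa (by
      rw [star_star]
      exact le_trans (le_add_of_nonneg_left (mul_star_self_nonneg b)) hle)
    have h2 := (abs_le_of_sq_le_sq' (this.trans hu) hε.le).2
    rw [← norm_star] at h2
    simpa [husa.star_eq] using h2

/-- When `e x ≈ x`, the elements `x` and `(1 - e) y` are nearly orthogonal, since `x* (1 - e) y =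
((1 - e) x)* y`. The norm therefore grows only to second order in `s`, apart from the error `η`. -/
theorem norm_add_smul_sub_mul_sq_le {x y e : A} {s η : ℝ} (hs : 0 ≤ s) (he0 : 0 ≤ e) (he1 : e ≤ 1)
    (hx : ‖x‖ ≤ 1) (hy : ‖y‖ ≤ 1) (hex : ‖x - e * x‖ ≤ η) :
    ‖x + s • (y - e * y)‖ ^ 2 ≤ 1 + s ^ 2 + 2 * s * η := by
  have hesa : IsSelfAdjoint e := .of_nonneg he0
  have h1e : ‖1 - e‖ ≤ 1 := by
    rw [CStarAlgebra.norm_le_one_iff_of_nonneg _ (sub_nonneg.2 he1)]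
    simpa using he0
  have hye : ‖y - e * y‖ ≤ 1 := by
    have : y - e * y = (1 - e) * y := by noncomm_ring
    rw [this]
    exact (norm_mul_le _ _).trans (mul_le_one₀ h1e (norm_nonneg _) hy)
  have hη : 0 ≤ η := (norm_nonneg _).trans hex
  have hcross : ‖star x * (y - e * y)‖ ≤ η := by
    have : star x * (y - e * y) = star (x - e * x) * y := by
      simp only [star_sub, star_mul, hesa.star_eq]; noncomm_ring
    rw [this]
    refine (norm_mul_le _ _).trans ?_
    rw [norm_star]
    calc ‖x - e * x‖ * ‖y‖ ≤ η * 1 := by gcongr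
      _ = η := mul_one _
  rw [sq, ← CStarRing.norm_star_mul_self]
  have hexp : star (x + s • (y - e * y)) * (x + s • (y - e * y))
      = star x * x + s • (star x * (y - e * y)) + s • star (star x * (y - e * y))
        + (s * s) • (star (y - e * y) * (y - e * y)) := by
    rw [star_mul (star x), star_star, mul_smul]
    generalize y - e * y = z
    simp only [star_add, star_smul, star_trivial, add_mul, mul_add, smul_mul_assoc,
      mul_smul_comm, smul_add]
    abel
  have hxx : ‖star x * x‖ ≤ 1 := by
    rw [CStarRing.norm_star_mul_self]; exact mul_le_one₀ hx (norm_nonneg _) hx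
  have hyy : ‖star (y - e * y) * (y - e * y)‖ ≤ 1 := by
    rw [CStarRing.norm_star_mul_self]; exact mul_le_one₀ hye (norm_nonneg _) hye
  rw [hexp]
  have h3 : ‖s • (star x * (y - e * y))‖ ≤ s * η := by
    rw [norm_smul, Real.norm_of_nonneg hs]; gcongr
  have h4 : ‖s • star (star x * (y - e * y))‖ ≤ s * η := by
    rw [norm_smul, Real.norm_of_nonneg hs, norm_star]; gcongr
  have h5 : ‖(s * s) • (star (y - e * y) * (y - e * y))‖ ≤ s * s * 1 := by
    rw [norm_smul, Real.norm_of_nonneg (by positivity)]; gcongr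
  have := norm_add_le (star x * x + s • (star x * (y - e * y)) + s • star (star x * (y - e * y)))
    ((s * s) • (star (y - e * y) * (y - e * y)))
  have := norm_add_le (star x * x + s • (star x * (y - e * y))) (s • star (star x * (y - e * y)))
  have := norm_add_le (star x * x) (s • (star x * (y - e * y)))
  nlinarith

/-- Choose `x` in the unit ball of the kernel almost norming `φ` there, and `e` with `e x ≈ x`. If
`φ ((1 - e) y)` were large, adding a small multiple of `(1 - e) y` to `x` would raise `φ` to first
order but the norm only to second order, contradicting that `x` is almost norming. -/
theorem exists_functional_factor (ρ : A →⋆ₐ[ℂ] D) (φ : A →L[ℝ] ℝ) {δ : ℝ} (hδ : 0 < δ) :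
    ∃ e : A, ρ e = 0 ∧ ∀ x, ρ x = 0 → |φ x - φ (e * x)| ≤ δ * ‖x‖ := by
  set S : Set ℝ := {c | ∃ x, ρ x = 0 ∧ ‖x‖ ≤ 1 ∧ φ x = c} with hS
  set N := sSup S with hN
  have hbdd : BddAbove S := by
    refine ⟨‖φ‖, ?_⟩
    rintro _ ⟨x, -, hx, rfl⟩
    calc φ x ≤ ‖φ x‖ := Real.le_norm_self _
      _ ≤ ‖φ‖ * ‖x‖ := φ.le_opNorm x
      _ ≤ ‖φ‖ * 1 := by gcongr
      _ = ‖φ‖ := mul_one _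
  have h0S : (0 : ℝ) ∈ S := ⟨0, map_zero _, by simp, map_zero _⟩
  have hN0 : 0 ≤ N := le_csSup hbdd h0S
  have hNle : ∀ z, ρ z = 0 → φ z ≤ N * ‖z‖ := by
    intro z hz
    rcases eq_or_ne z 0 with rfl | hz0
    · simp
    · have hpos : 0 < ‖z‖ := norm_pos_iff.2 hz0
      have hmem : ‖z‖⁻¹ * φ z ∈ S := by
        refine ⟨(‖z‖⁻¹ : ℝ) • z, ?_, ?_, by simp⟩
        · exact ρ.map_real_smul_eq_zero _ hz
        · rw [norm_smul, norm_inv, norm_norm, inv_mul_cancel₀ hpos.ne']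
      have := le_csSup hbdd hmem
      rw [inv_mul_le_iff₀ hpos] at this
      linarith
  -- With these values `N (s / 2 + η) ≤ 3 δ / 4`; the defect `s δ / 4` in the choice of `x` supplies
  -- the last quarter after division by `s`. The `+ 1` covers `N = 0`.
  set s := δ / (N + 1) with hs
  set η := δ / (4 * (N + 1)) with hη
  have hs0 : 0 < s := by positivity
  have hη0 : 0 < η := by positivity
  obtain ⟨_, ⟨x, hρx, hx1, rfl⟩, hx⟩ := exists_lt_of_lt_csSup ⟨0, h0S⟩
    (show N - s * (δ / 4) < sSup S by rw [← hN]; have := mul_pos hs0 hδ; linarith)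
  obtain ⟨e, he0, he1, hρe, he⟩ := exists_approx_unit_ker ρ {x} hη0
  have hex := (he x (by simp) hρx).1
  have key : ∀ y, ρ y = 0 → ‖y‖ ≤ 1 → φ (y - e * y) ≤ δ := by
    intro y hρy hy
    have h1 := norm_add_smul_sub_mul_sq_le hs0.le he0 he1 hx1 hy hex
    have h2 : φ x + s * φ (y - e * y) ≤ N * ‖x + s • (y - e * y)‖ := by
      have := hNle (x + s • (y - e * y)) (by
        rw [map_add, hρx, zero_add]
        exact ρ.map_real_smul_eq_zero _ (by simp [hρy]))
      simpa using this
    have h3 : ‖x + s • (y - e * y)‖ ≤ 1 + (s ^ 2 + 2 * s * η) / 2 := by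
      nlinarith [sq_nonneg (‖x + s • (y - e * y)‖ - 1)]
    have h4 : s * φ (y - e * y) ≤ N * ((s ^ 2 + 2 * s * η) / 2) + s * (δ / 4) := by
      nlinarith [mul_le_mul_of_nonneg_left h3 hN0]
    have h5 : φ (y - e * y) ≤ N * (s / 2 + η) + δ / 4 := by
      have : s * φ (y - e * y) ≤ s * (N * (s / 2 + η) + δ / 4) := by linarith
      exact le_of_mul_le_mul_left this hs0
    have h6 : N * (s / 2 + η) ≤ 3 / 4 * δ := by
      have : N * (s / 2 + η) = (N / (N + 1)) * (3 / 4 * δ) := by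
        rw [hs, hη]; field_simp; ring
      rw [this]
      have h7 : N / (N + 1) ≤ 1 := by rw [div_le_one (by positivity)]; linarith
      nlinarith
    linarith
  have key2 : ∀ y, ρ y = 0 → φ (y - e * y) ≤ δ * ‖y‖ := by
    intro y hρy
    rcases eq_or_ne y 0 with rfl | hy0
    · simp
    · have hpos : 0 < ‖y‖ := norm_pos_iff.2 hy0
      have := key ((‖y‖⁻¹ : ℝ) • y) (ρ.map_real_smul_eq_zero _ hρy)
        (by rw [norm_smul, norm_inv, norm_norm, inv_mul_cancel₀ hpos.ne'])
      rw [mul_smul_comm, ← smul_sub, map_smul, smul_eq_mul, inv_mul_le_iff₀ hpos] at this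
      linarith
  refine ⟨e, hρe, fun y hρy => ?_⟩
  rw [← map_sub, abs_le]
  refine ⟨?_, key2 y hρy⟩
  have := key2 (-y) (by simp [hρy])
  rw [norm_neg, mul_neg, ← neg_sub', map_neg] at this
  linarith

/-- The admissible `u` form a convex set, so either their commutator tuples accumulate at `0` or
Hahn–Banach separates these from `0`. Separation is impossible: every component of the functional is
small on commutators with a sufficiently good approximate unit. -/
theorem exists_quasicentral_finset (ρ : A →⋆ₐ[ℂ] D) (s : Finset A) {ε : ℝ} (hε : 0 < ε) :
    ∃ u : A, 0 ≤ u ∧ u ≤ 1 ∧ ρ u = 0 ∧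
      (∀ b ∈ s, ρ b = 0 → ‖b - u * b‖ ≤ ε) ∧ ∀ a ∈ s, ‖u * a - a * u‖ ≤ ε := by
  classical
  set K : Set A := {u | 0 ≤ u ∧ u ≤ 1 ∧ ρ u = 0 ∧ ∀ b ∈ s, ρ b = 0 → ‖b - u * b‖ ≤ ε} with hK
  let T : A →ₗ[ℝ] (s → A) :=
    { toFun := fun u a => u * a - a * u
      map_add' := fun u v => by ext a; simp only [Pi.add_apply]; noncomm_ring
      map_smul' := fun c u => by ext a; simp [smul_sub] }
  have hKconv : Convex ℝ K := by
    rintro u ⟨hu0, hu1, hρu, hu⟩ v ⟨hv0, hv1, hρv, hv⟩ a b ha hb hab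
    refine ⟨add_nonneg (smul_nonneg ha hu0) (smul_nonneg hb hv0), ?_, ?_, fun c hc hρc => ?_⟩
    · calc a • u + b • v ≤ a • (1 : A) + b • (1 : A) :=
          add_le_add (smul_le_smul_of_nonneg_left hu1 ha) (smul_le_smul_of_nonneg_left hv1 hb)
        _ = 1 := by rw [← add_smul, hab, one_smul]
    · rw [map_add, ρ.map_real_smul_eq_zero _ hρu, ρ.map_real_smul_eq_zero _ hρv, add_zero]
    · have : c - (a • u + b • v) * c = a • (c - u * c) + b • (c - v * c) := by
        rw [smul_sub, smul_sub, add_mul, smul_mul_assoc, smul_mul_assoc]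
        nth_rewrite 1 [← one_smul ℝ c]
        rw [← hab, add_smul]; abel
      rw [this]
      calc ‖a • (c - u * c) + b • (c - v * c)‖ ≤ ‖a • (c - u * c)‖ + ‖b • (c - v * c)‖ :=
            norm_add_le _ _
        _ ≤ a * ε + b * ε := by
            rw [norm_smul, norm_smul, Real.norm_of_nonneg ha, Real.norm_of_nonneg hb]
            have := hu c hc hρc
            have := hv c hc hρc
            gcongr
        _ = ε := by rw [← add_mul, hab, one_mul]
  by_cases h0 : (0 : s → A) ∈ closure (T '' K)
  · obtain ⟨_, ⟨u, ⟨hu0, hu1, hρu, hu⟩, rfl⟩, hdist⟩ := Metric.mem_closure_iff.1 h0 ε hε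
    refine ⟨u, hu0, hu1, hρu, hu, fun a ha => ?_⟩
    rw [dist_zero_left] at hdist
    exact (norm_le_pi_norm (T u) ⟨a, ha⟩).trans hdist.le
  exfalso
  obtain ⟨φ, c, hφ0, hφ⟩ := geometric_hahn_banach_point_closed
    (hKconv.linear_image T).closure isClosed_closure h0
  rw [map_zero] at hφ0
  let φi : s → A →L[ℝ] ℝ := fun a => φ.comp (ContinuousLinearMap.single ℝ (fun _ : s => A) a)
  have hsum : ∀ v : s → A, φ v = ∑ a, φi a (v a) := by
    intro v
    conv_lhs => rw [← Finset.univ_sum_single v]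
    rw [map_sum]
    rfl
  set M := ∑ a : s, (2 * ‖(a : A)‖ + ‖φi a‖ * (‖(a : A)‖ + 1)) with hM
  have hM0 : 0 ≤ M := Finset.sum_nonneg fun a _ => by positivity
  -- Here `c > 0` by separation from `0`, and `δ M ≤ c` contradicts the strict lower bound `c` on
  -- the commutator tuples.
  set δ := min ε (c / (M + 1)) with hδ
  have hδ0 : 0 < δ := lt_min hε (by positivity)
  choose e hρe he using fun a : s => exists_functional_factor ρ (φi a) hδ0
  obtain ⟨u, hu0, hu1, hρu, hu⟩ := exists_approx_unit_ker ρ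
    (s ∪ (Finset.univ.image e ∪ Finset.univ.image fun a : s => e a * a)) hδ0
  have hun : ‖u‖ ≤ 1 := (CStarAlgebra.norm_le_one_iff_of_nonneg u hu0).2 hu1
  have huK : u ∈ K := ⟨hu0, hu1, hρu, fun b hb hρb =>
    ((hu b (by simp [hb]) hρb).1).trans (min_le_left _ _)⟩
  have hlow := hφ _ (subset_closure ⟨u, huK, rfl⟩)
  have hup : φ (T u) ≤ δ * M := by
    rw [hsum, hM, Finset.mul_sum]
    refine Finset.sum_le_sum fun a _ => ?_
    exact functional_commutator_le ρ (φi a) hun hρu (he a)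
      (hu (e a * a) (by simp) (by simp [hρe])).2 (hu (e a) (by simp) (hρe a)).2
  have h1 : δ * M ≤ c / (M + 1) * M := by
    gcongr; exact min_le_right _ _
  have h2 : c / (M + 1) * M ≤ c := by
    rw [div_mul_eq_mul_div, div_le_iff₀ (by positivity)]
    nlinarith
  linarith

/-- A quasicentral approximate unit, as a filter, for the kernel of a `*`-homomorphism. -/
structure IsQuasicentralFilter (ρ : A →⋆ₐ[ℂ] D) (l : Filter A) : Prop where
  mem_ker : ∀ᶠ u in l, 0 ≤ u ∧ u ≤ 1 ∧ ρ u = 0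
  tendsto_commutator : ∀ a : A, Tendsto (fun u => u * a - a * u) l (𝓝 0)
  tendsto_mul : ∀ b : A, ρ b = 0 → Tendsto (fun u => u * b) l (𝓝 b)

theorem exists_isQuasicentralFilter (ρ : A →⋆ₐ[ℂ] D) :
    ∃ l : Filter A, l.NeBot ∧ IsQuasicentralFilter ρ l := by
  classical
  let S : Finset A × {ε : ℝ // 0 < ε} → Set A := fun i =>
    {u | 0 ≤ u ∧ u ≤ 1 ∧ ρ u = 0 ∧ (∀ b ∈ i.1, ρ b = 0 → ‖b - u * b‖ ≤ i.2) ∧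
      ∀ a ∈ i.1, ‖u * a - a * u‖ ≤ i.2}
  have : Nonempty {ε : ℝ // 0 < ε} := ⟨⟨1, one_pos⟩⟩
  refine ⟨⨅ i, 𝓟 (S i), iInf_neBot_of_directed' ?_ fun i => ?_, ?_, fun a => ?_, fun b hb => ?_⟩
  · intro i j
    refine ⟨(i.1 ∪ j.1, ⟨min i.2 j.2, lt_min i.2.2 j.2.2⟩), ?_, ?_⟩ <;>
      refine principal_mono.2 fun u ⟨h0, h1, h2, h3, h4⟩ => ⟨h0, h1, h2, fun b hb hρ => ?_,
        fun a ha => ?_⟩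
    · exact (h3 b (Finset.mem_union_left _ hb) hρ).trans (min_le_left _ _)
    · exact (h4 a (Finset.mem_union_left _ ha)).trans (min_le_left _ _)
    · exact (h3 b (Finset.mem_union_right _ hb) hρ).trans (min_le_right _ _)
    · exact (h4 a (Finset.mem_union_right _ ha)).trans (min_le_right _ _)
  · exact principal_neBot_iff.2 (exists_quasicentral_finset ρ i.1 i.2.2)
  · exact mem_iInf_of_mem (∅, ⟨1, one_pos⟩) fun u hu => ⟨hu.1, hu.2.1, hu.2.2.1⟩
  · rw [Metric.tendsto_nhds]
    intro ε hε
    refine mem_iInf_of_mem ({a}, ⟨ε / 2, half_pos hε⟩) fun u hu => ?_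
    have := hu.2.2.2.2 a (by simp)
    simp only [Set.mem_ofPred_eq, dist_zero_right]
    exact this.trans_lt (half_lt_self hε)
  · rw [Metric.tendsto_nhds]
    intro ε hε
    refine mem_iInf_of_mem ({b}, ⟨ε / 2, half_pos hε⟩) fun u hu => ?_
    have := hu.2.2.2.1 b (by simp) hb
    simp only [Set.mem_ofPred_eq]
    rw [dist_comm, dist_eq_norm]
    exact this.trans_lt (half_lt_self hε)

end Quasicentral

/-! ### Approximate intertwining, functional calculus, and order up to a vanishing error. -/

section Asymptotics

variable {A ι : Type*} [CStarAlgebra A] {l : Filter ι}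

theorem tendsto_mul_zero_of_bounded {f g : ι → A} {K : ℝ} (hg : ∀ᶠ i in l, ‖g i‖ ≤ K)
    (hf : Tendsto f l (𝓝 0)) : Tendsto (fun i => g i * f i) l (𝓝 0) := by
  refine squeeze_zero_norm' (hg.mono fun i hi => (norm_mul_le _ _).trans
    (mul_le_mul_of_nonneg_right hi (norm_nonneg _))) ?_
  simpa using hf.norm.const_mul K

theorem tendsto_zero_mul_of_bounded {f g : ι → A} {K : ℝ} (hg : ∀ᶠ i in l, ‖g i‖ ≤ K)
    (hf : Tendsto f l (𝓝 0)) : Tendsto (fun i => f i * g i) l (𝓝 0) := by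
  refine squeeze_zero_norm' (hg.mono fun i hi => (norm_mul_le _ _).trans
    (mul_le_mul_of_nonneg_left hi (norm_nonneg _))) ?_
  simpa using hf.norm.mul_const K

theorem eventually_norm_mul_le {f g : ι → A} {K L : ℝ} (hf : ∀ᶠ i in l, ‖f i‖ ≤ K)
    (hg : ∀ᶠ i in l, ‖g i‖ ≤ L) : ∀ᶠ i in l, ‖f i * g i‖ ≤ K * L := by
  filter_upwards [hf, hg] with i h1 h2
  exact (norm_mul_le _ _).trans (mul_le_mul h1 h2 (norm_nonneg _) ((norm_nonneg _).trans h1))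

theorem tendsto_mul_sq_mul_sub {p q : ι → A} {K L : ℝ} (hp : ∀ᶠ i in l, ‖p i‖ ≤ K)
    (hq : ∀ᶠ i in l, ‖q i‖ ≤ L) (h : Tendsto (fun i => p i * q i - q i * p i) l (𝓝 0)) :
    Tendsto (fun i => p i * (q i * q i) * p i - q i * (p i * p i) * q i) l (𝓝 0) := by
  have h1 := tendsto_zero_mul_of_bounded (eventually_norm_mul_le hq hp) h
  have h2 := tendsto_mul_zero_of_bounded (eventually_norm_mul_le hq hp) h
  have := h1.sub h2
  rw [sub_zero] at this
  refine this.congr fun i => ?_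
  noncomm_ring

/-- Two different elements `a`, `c` are allowed so that `c = a` gives commutators and `b = 1`
compares the functional calculi of two nearby elements. -/
theorem tendsto_aeval_intertwine {a b c : ι → A} {R : ℝ}
    (ha : ∀ᶠ i in l, ‖a i‖ ≤ R) (hc : ∀ᶠ i in l, ‖c i‖ ≤ R)
    (h : Tendsto (fun i => a i * b i - b i * c i) l (𝓝 0)) (P : Polynomial ℝ) :
    Tendsto (fun i => P.aeval (a i) * b i - b i * P.aeval (c i)) l (𝓝 0) := by
  induction P using Polynomial.induction_on' with
  | add P Q hP hQ =>
    have := hP.add hQ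
    rw [add_zero] at this
    refine this.congr fun i => ?_
    simp only [map_add]
    noncomm_ring
  | monomial n r =>
    have key : Tendsto (fun i => a i ^ n * b i - b i * c i ^ n) l (𝓝 0) := by
      induction n with
      | zero => simpa using tendsto_const_nhds
      | succ n ih =>
        have h1 := tendsto_zero_mul_of_bounded hc ih
        have hb : ∃ K, ∀ᶠ i in l, ‖a i ^ n‖ ≤ K := by
          clear ih h1
          induction n with
          | zero => exact ⟨‖(1 : A)‖, by simp⟩
          | succ n ih =>
            obtain ⟨K, hK⟩ := ih
            exact ⟨K * R, by simpa [pow_succ] using eventually_norm_mul_le hK ha⟩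
        obtain ⟨K, hK⟩ := hb
        have h2 := tendsto_mul_zero_of_bounded hK h
        have := h2.add h1
        rw [add_zero] at this
        refine this.congr fun i => ?_
        rw [pow_succ, pow_succ]
        noncomm_ring
    have := key.const_smul r
    rw [smul_zero] at this
    refine this.congr fun i => ?_
    simp only [Polynomial.aeval_monomial, smul_sub, Algebra.algebraMap_eq_smul_one,
      smul_mul_assoc, one_mul, mul_smul_comm]

theorem tendsto_conj_commutator {h : ι → A} (hh : ∀ᶠ i in l, IsSelfAdjoint (h i) ∧ ‖h i‖ ≤ 1)
    (hcomm : ∀ a, Tendsto (fun i => h i * a - a * h i) l (𝓝 0)) {q b : A} (hqb : Commute q b) :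
    Tendsto (fun i => q * (h i * h i) * q * b - b * (q * (h i * h i) * q)) l (𝓝 0) := by
  have h1 : ∀ᶠ i in l, ‖h i‖ ≤ 1 := hh.mono fun i hi => hi.2
  have e1 := tendsto_mul_zero_of_bounded h1 (hcomm b)
  have e2 := tendsto_zero_mul_of_bounded h1 (hcomm b)
  have e3 := ((e1.add e2).const_mul q).mul_const q
  simp only [add_zero, mul_zero, zero_mul] at e3
  refine e3.congr fun i => ?_
  have hqb' : q * b = b * q := hqb
  calc q * (h i * (h i * b - b * h i) + (h i * b - b * h i) * h i) * q
      = q * (h i * h i) * (b * q) - (q * b) * (h i * h i) * q := by noncomm_ring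
    _ = q * (h i * h i) * (q * b) - (b * q) * (h i * h i) * q := by rw [hqb']
    _ = _ := by noncomm_ring

variable [PartialOrder A] [StarOrderedRing A]

theorem spectrum_subset_Icc_of_norm_le {a : A} {R : ℝ} (ha : 0 ≤ a) (haR : ‖a‖ ≤ R) :
    spectrum ℝ a ⊆ Set.Icc 0 R := fun t ht => by
  refine ⟨spectrum_nonneg_of_nonneg ha ht, ?_⟩
  have : Nontrivial A := by
    by_contra hA
    rw [not_nontrivial_iff_subsingleton] at hA
    simp [spectrum.of_subsingleton] at ht
  exact (Real.le_norm_self t).trans ((spectrum.norm_le_norm_of_mem ht).trans haR)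

/-- Weierstrass approximation on `[0, R]` is uniform in the index because all spectra lie there,
which reduces the claim to polynomials. -/
theorem tendsto_cfc_intertwine {a b c : ι → A} {R K : ℝ}
    (ha : ∀ᶠ i in l, 0 ≤ a i ∧ ‖a i‖ ≤ R) (hc : ∀ᶠ i in l, 0 ≤ c i ∧ ‖c i‖ ≤ R)
    (hb : ∀ᶠ i in l, ‖b i‖ ≤ K)
    (h : Tendsto (fun i => a i * b i - b i * c i) l (𝓝 0)) {f : ℝ → ℝ}
    (hf : ContinuousOn f (Set.Icc 0 R)) :
    Tendsto (fun i => cfc f (a i) * b i - b i * cfc f (c i)) l (𝓝 0) := by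
  rw [Metric.tendsto_nhds]
  intro ε hε
  set δ := ε / (2 * (|K| + 1)) with hδ
  have hδ0 : 0 < δ := by positivity
  obtain ⟨P, hP⟩ := exists_polynomial_near_of_continuousOn 0 R f hf (δ / 2) (by positivity)
  have hnear : ∀ x : A, 0 ≤ x → ‖x‖ ≤ R → ‖cfc f x - P.aeval x‖ ≤ δ / 2 := by
    intro x hx hxR
    have hsp := spectrum_subset_Icc_of_norm_le hx hxR
    rw [← cfc_polynomial P x, ← cfc_sub f (fun t => P.eval t) x (hf.mono hsp)
      (Polynomial.continuous P).continuousOn]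
    refine norm_cfc_le (by positivity) fun t ht => ?_
    rw [norm_sub_rev]
    exact (hP t (hsp ht)).le
  have hpol := tendsto_aeval_intertwine (ha.mono fun i hi => hi.2) (hc.mono fun i hi => hi.2) h P
  rw [Metric.tendsto_nhds] at hpol
  filter_upwards [ha, hc, hb, hpol (ε / 2) (half_pos hε)] with i hai hci hbi hpi
  rw [dist_zero_right] at hpi ⊢
  have h1 := hnear _ hai.1 hai.2
  have h2 := hnear _ hci.1 hci.2
  have e1 : cfc f (a i) * b i - b i * cfc f (c i)
      = (P.aeval (a i) * b i - b i * P.aeval (c i)) + (cfc f (a i) - P.aeval (a i)) * b i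
        - b i * (cfc f (c i) - P.aeval (c i)) := by noncomm_ring
  have hbK : ‖b i‖ ≤ |K| := hbi.trans (le_abs_self K)
  have h3 : ‖(cfc f (a i) - P.aeval (a i)) * b i‖ ≤ δ / 2 * |K| :=
    (norm_mul_le _ _).trans (by gcongr)
  have h4 : ‖b i * (cfc f (c i) - P.aeval (c i))‖ ≤ |K| * (δ / 2) :=
    (norm_mul_le _ _).trans (by gcongr)
  have h5 : δ * (|K| + 1) = ε / 2 := by rw [hδ]; field_simp
  rw [e1]
  have h6 := norm_sub_le ((P.aeval (a i) * b i - b i * P.aeval (c i))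
    + (cfc f (a i) - P.aeval (a i)) * b i) (b i * (cfc f (c i) - P.aeval (c i)))
  have h7 := norm_add_le (P.aeval (a i) * b i - b i * P.aeval (c i))
    ((cfc f (a i) - P.aeval (a i)) * b i)
  linarith

/-- `F i ≤ G i` up to an error that tends to zero along `l`. -/
def AsympLE (l : Filter ι) (F G : ι → A) : Prop :=
  ∀ ε : ℝ, 0 < ε → ∀ᶠ i in l, F i ≤ G i + algebraMap ℝ A ε

theorem AsympLE.of_le {F G : ι → A} (h : ∀ᶠ i in l, F i ≤ G i) : AsympLE l F G := fun ε hε => by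
  filter_upwards [h] with i hi
  exact hi.trans (le_add_of_nonneg_right (algebraMap_nonneg A hε.le))

theorem AsympLE.trans {F G H : ι → A} (h1 : AsympLE l F G) (h2 : AsympLE l G H) :
    AsympLE l F H := fun ε hε => by
  filter_upwards [h1 _ (half_pos hε), h2 _ (half_pos hε)] with i hi1 hi2
  calc F i ≤ G i + algebraMap ℝ A (ε / 2) := hi1
    _ ≤ H i + algebraMap ℝ A (ε / 2) + algebraMap ℝ A (ε / 2) := by gcongr
    _ = H i + algebraMap ℝ A ε := by rw [add_assoc, ← map_add, add_halves]

theorem AsympLE.of_tendsto {F G : ι → A} (hF : ∀ᶠ i in l, IsSelfAdjoint (F i - G i))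
    (h : Tendsto (fun i => F i - G i) l (𝓝 0)) : AsympLE l F G := fun ε hε => by
  rw [Metric.tendsto_nhds] at h
  filter_upwards [hF, h ε hε] with i hi1 hi2
  rw [dist_zero_right] at hi2
  rw [← sub_le_iff_le_add']
  exact (hi1.le_algebraMap_norm_self).trans (algebraMap_mono A hi2.le)

theorem AsympLE.conj {F G c : ι → A} {K : ℝ} (h : AsympLE l F G) (hc : ∀ᶠ i in l, ‖c i‖ ≤ K) :
    AsympLE l (fun i => star (c i) * F i * c i) (fun i => star (c i) * G i * c i) := by
  intro ε hε
  filter_upwards [h (ε / (K ^ 2 + 1)) (by positivity), hc] with i hi hci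
  refine (star_left_conjugate_le_conjugate hi (c i)).trans ?_
  rw [mul_add, add_mul]
  gcongr
  have h1 : star (c i) * (algebraMap ℝ A) (ε / (K ^ 2 + 1)) * c i
      = (ε / (K ^ 2 + 1)) • (star (c i) * c i) := by
    rw [Algebra.algebraMap_eq_smul_one, mul_smul_comm, mul_one, smul_mul_assoc]
  rw [h1]
  have h2 : star (c i) * c i ≤ algebraMap ℝ A (K ^ 2) := by
    refine (IsSelfAdjoint.star_mul_self (c i)).le_algebraMap_norm_self.trans
      (algebraMap_mono A ?_)
    rw [CStarRing.norm_star_mul_self, ← sq]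
    gcongr
  calc (ε / (K ^ 2 + 1)) • (star (c i) * c i)
      ≤ (ε / (K ^ 2 + 1)) • algebraMap ℝ A (K ^ 2) :=
        smul_le_smul_of_nonneg_left h2 (by positivity)
    _ = algebraMap ℝ A (ε / (K ^ 2 + 1) * K ^ 2) := by
        rw [map_mul, Algebra.smul_def]
    _ ≤ algebraMap ℝ A ε := algebraMap_mono A (by
        rw [div_mul_eq_mul_div, div_le_iff₀ (by positivity)]; nlinarith)

theorem AsympLE.sum {κ : Type*} (s : Finset κ) {F G : κ → ι → A}
    (h : ∀ k ∈ s, AsympLE l (F k) (G k)) :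
    AsympLE l (fun i => ∑ k ∈ s, F k i) (fun i => ∑ k ∈ s, G k i) := by
  classical
  induction s using Finset.induction_on with
  | empty => exact .of_le (by simp)
  | insert k s hk ih =>
    intro ε hε
    filter_upwards [h k (by simp) _ (half_pos hε),
      ih (fun j hj => h j (by simp [hj])) _ (half_pos hε)] with i h1 h2
    rw [Finset.sum_insert hk, Finset.sum_insert hk]
    calc F k i + ∑ k ∈ s, F k i ≤ (G k i + algebraMap ℝ A (ε / 2))
          + (∑ k ∈ s, G k i + algebraMap ℝ A (ε / 2)) := add_le_add h1 h2
      _ = _ := by rw [add_add_add_comm, ← map_add, add_halves]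

end Asymptotics

/-! ### Powers of compressions `h X h` by asymptotically central contractions. -/

section Rpow

variable {A : Type*} [CStarAlgebra A] [PartialOrder A] [StarOrderedRing A]

theorem CFC.rpow_mul_rpow_of_nonneg {X : A} (hX : 0 ≤ X) {a b : ℝ} (ha : 0 ≤ a) (hb : 0 ≤ b) :
    X ^ a * X ^ b = X ^ (a + b) := by
  rw [CFC.rpow_eq_cfc_real hX, CFC.rpow_eq_cfc_real hX, CFC.rpow_eq_cfc_real hX,
    ← cfc_mul (fun x : ℝ => x ^ a) (fun x : ℝ => x ^ b) X
      (Real.continuous_rpow_const ha).continuousOn (Real.continuous_rpow_const hb).continuousOn]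
  refine cfc_congr fun t ht => ?_
  exact (Real.rpow_add_of_nonneg (spectrum_nonneg_of_nonneg hX ht) ha hb).symm

variable {ι : Type*} {l : Filter ι} {h : ι → A}

theorem conj_sq_le {q h : A} (hq : IsSelfAdjoint q) (hh : IsSelfAdjoint h) (h1 : ‖h‖ ≤ 1) :
    q * (h * h) * q ≤ q * q := by
  have h2 : h * h ≤ 1 := by
    have : 0 ≤ h * h := by simpa [hh.star_eq] using star_mul_self_nonneg h
    rw [← CStarAlgebra.norm_le_one_iff_of_nonneg _ this]
    exact (norm_mul_le _ _).trans (mul_le_one₀ h1 (norm_nonneg _) h1)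
  simpa [hq.star_eq] using star_left_conjugate_le_conjugate h2 q

theorem conj_sq_nonneg {q h : A} (hq : IsSelfAdjoint q) (hh : IsSelfAdjoint h) :
    0 ≤ q * (h * h) * q := by
  have := star_mul_self_nonneg (h * q)
  simp only [star_mul, hq.star_eq, hh.star_eq] at this
  simpa [mul_assoc] using this

/-- With `V = X^(1/2) h² X^(1/2)`, conjugating the hypothesis by `V^(1/2)` gives `V^(r+1) ≲ V^(1/2)
X^r V^(1/2)`. Since `V` asymptotically commutes with `X^(r/2)`, the right side is close to `X^(r/2)
V X^(r/2)`. This replaces operator monotonicity above exponent `1`. -/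
theorem asympLE_rpow_succ {X : A} (hX : 0 ≤ X)
    (hh : ∀ᶠ i in l, IsSelfAdjoint (h i) ∧ ‖h i‖ ≤ 1)
    (hcomm : ∀ a, Tendsto (fun i => h i * a - a * h i) l (𝓝 0)) {r : ℝ} (hr : 0 ≤ r)
    (hV : AsympLE l (fun i => (X ^ (1 / 2 : ℝ) * (h i * h i) * X ^ (1 / 2 : ℝ)) ^ r)
      (fun _ => X ^ r)) :
    AsympLE l (fun i => (X ^ (1 / 2 : ℝ) * (h i * h i) * X ^ (1 / 2 : ℝ)) ^ (r + 1))
      (fun i => X ^ ((r + 1) / 2) * (h i * h i) * X ^ ((r + 1) / 2)) := by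
  set q := X ^ (1 / 2 : ℝ) with hqdef
  set V : ι → A := fun i => q * (h i * h i) * q with hVdef
  have hqsa : IsSelfAdjoint q := .of_nonneg CFC.rpow_nonneg
  have hqq : q * q = X := by
    rw [hqdef, CFC.rpow_mul_rpow_of_nonneg hX (by norm_num) (by norm_num), add_halves,
      CFC.rpow_one X]
  have hV0 : ∀ᶠ i in l, 0 ≤ V i := hh.mono fun i hi => conj_sq_nonneg hqsa hi.1
  have hVX : ∀ᶠ i in l, V i ≤ X := hh.mono fun i hi => by
    rw [← hqq]; exact conj_sq_le hqsa hi.1 hi.2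
  have hVn : ∀ᶠ i in l, 0 ≤ V i ∧ ‖V i‖ ≤ ‖X‖ := by
    filter_upwards [hV0, hVX] with i h0 h1
    exact ⟨h0, CStarAlgebra.norm_le_norm_of_nonneg_of_le h0 h1⟩
  have hsqn : ∀ᶠ i in l, ‖V i ^ (1 / 2 : ℝ)‖ ≤ ‖q‖ := by
    filter_upwards [hVX] with i h1
    exact CStarAlgebra.norm_le_norm_of_nonneg_of_le CFC.rpow_nonneg
      (CFC.monotone_rpow (by constructor <;> norm_num) h1)
  set b := X ^ (r / 2) with hbdef
  have hbsa : IsSelfAdjoint b := .of_nonneg CFC.rpow_nonneg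
  have hqb : Commute q b := by
    rw [hqdef, hbdef, commute_iff_eq, CFC.rpow_mul_rpow_of_nonneg hX (by norm_num) (by positivity),
      CFC.rpow_mul_rpow_of_nonneg hX (by positivity) (by norm_num), add_comm]
  have hcommV := tendsto_conj_commutator hh hcomm hqb
  have hcommS : Tendsto (fun i => V i ^ (1 / 2 : ℝ) * b - b * V i ^ (1 / 2 : ℝ)) l (𝓝 0) := by
    have := tendsto_cfc_intertwine (b := fun _ => b) (K := ‖b‖) hVn hVn (by simp) hcommV
      (f := fun t : ℝ => t ^ (1 / 2 : ℝ)) (Real.continuous_rpow_const (by norm_num)).continuousOn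
    refine this.congr' ?_
    filter_upwards [hV0] with i hi
    rw [CFC.rpow_eq_cfc_real hi]
  have step1 : AsympLE l (fun i => V i ^ (r + 1))
      (fun i => V i ^ (1 / 2 : ℝ) * (b * b) * V i ^ (1 / 2 : ℝ)) := by
    have := hV.conj (c := fun i => V i ^ (1 / 2 : ℝ)) hsqn
    refine (AsympLE.of_le ?_).trans (this.trans (.of_le ?_))
    · filter_upwards [hV0] with i hi
      have hs : star (V i ^ (1 / 2 : ℝ)) = V i ^ (1 / 2 : ℝ) :=
        (IsSelfAdjoint.of_nonneg CFC.rpow_nonneg).star_eq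
      rw [hs, CFC.rpow_mul_rpow_of_nonneg hi (by norm_num) hr,
        CFC.rpow_mul_rpow_of_nonneg hi (by positivity) (by norm_num)]
      exact le_of_eq (by congr 1; ring)
    · refine .of_forall fun i => ?_
      have hs : star (V i ^ (1 / 2 : ℝ)) = V i ^ (1 / 2 : ℝ) :=
        (IsSelfAdjoint.of_nonneg CFC.rpow_nonneg).star_eq
      rw [hs, hbdef, CFC.rpow_mul_rpow_of_nonneg hX (by positivity) (by positivity), add_halves]
  have step2 : AsympLE l (fun i => V i ^ (1 / 2 : ℝ) * (b * b) * V i ^ (1 / 2 : ℝ))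
      (fun i => b * (V i ^ (1 / 2 : ℝ) * V i ^ (1 / 2 : ℝ)) * b) := by
    refine .of_tendsto (.of_forall fun i => ?_)
      (tendsto_mul_sq_mul_sub (q := fun _ => b) (L := ‖b‖) hsqn (by simp) hcommS)
    have hs : IsSelfAdjoint (V i ^ (1 / 2 : ℝ)) := .of_nonneg CFC.rpow_nonneg
    exact (IsSelfAdjoint.of_nonneg (conj_sq_nonneg hs hbsa)).sub
      (IsSelfAdjoint.of_nonneg (conj_sq_nonneg hbsa hs))
  refine step1.trans (step2.trans (.of_le ?_))
  filter_upwards [hV0] with i hi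
  rw [CFC.rpow_mul_rpow_of_nonneg hi (by norm_num) (by norm_num), add_halves, CFC.rpow_one _]
  have h1 : b * q = X ^ ((r + 1) / 2) := by
    rw [hbdef, hqdef, CFC.rpow_mul_rpow_of_nonneg hX (by positivity) (by norm_num)]
    congr 1; ring
  have h2 : q * b = X ^ ((r + 1) / 2) := by rw [← h1]; exact hqb
  have h3 : b * (q * (h i * h i) * q) * b = (b * q) * (h i * h i) * (q * b) := by noncomm_ring
  exact le_of_eq (by rw [h3, h1, h2])

/-- Induction on the integer part of the exponent; the base case on `[0, 1]` is the Löwner–Heinz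
inequality applied to `X^(1/2) h² X^(1/2) ≤ X`. -/
theorem asympLE_rpow {X : A} (hX : 0 ≤ X)
    (hh : ∀ᶠ i in l, IsSelfAdjoint (h i) ∧ ‖h i‖ ≤ 1)
    (hcomm : ∀ a, Tendsto (fun i => h i * a - a * h i) l (𝓝 0)) {r : ℝ} (hr : 0 ≤ r) :
    AsympLE l (fun i => (X ^ (1 / 2 : ℝ) * (h i * h i) * X ^ (1 / 2 : ℝ)) ^ r)
      (fun _ => X ^ r) := by
  have hqsa : IsSelfAdjoint (X ^ (1 / 2 : ℝ)) := .of_nonneg CFC.rpow_nonneg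
  have main : ∀ (n : ℕ) (t : ℝ), t ∈ Set.Icc (0 : ℝ) 1 →
      AsympLE l (fun i => (X ^ (1 / 2 : ℝ) * (h i * h i) * X ^ (1 / 2 : ℝ)) ^ (t + n))
        (fun _ => X ^ (t + n)) := by
    intro n t ht
    induction n with
    | zero =>
      simp only [Nat.cast_zero, add_zero]
      refine .of_le (hh.mono fun i hi => CFC.monotone_rpow ht ?_)
      refine (conj_sq_le hqsa hi.1 hi.2).trans_eq ?_
      rw [CFC.rpow_mul_rpow_of_nonneg hX (by norm_num) (by norm_num), add_halves, CFC.rpow_one X]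
    | succ n ih =>
      have ht0 := ht.1
      push_cast
      rw [← add_assoc]
      refine (asympLE_rpow_succ hX hh hcomm (by positivity) ih).trans (.of_le ?_)
      refine hh.mono fun i hi => ?_
      refine (conj_sq_le (.of_nonneg CFC.rpow_nonneg) hi.1 hi.2).trans_eq ?_
      rw [CFC.rpow_mul_rpow_of_nonneg hX (by positivity) (by positivity), add_halves]
  have := main ⌊r⌋₊ (r - ⌊r⌋₊) ⟨sub_nonneg.2 (Nat.floor_le hr), by
    linarith [Nat.lt_floor_add_one r]⟩
  simpa using this

theorem asympLE_conj_rpow {X : A} (hX : 0 ≤ X)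
    (hh : ∀ᶠ i in l, IsSelfAdjoint (h i) ∧ ‖h i‖ ≤ 1)
    (hcomm : ∀ a, Tendsto (fun i => h i * a - a * h i) l (𝓝 0)) {s : ℝ} (hs : 1 ≤ s) :
    AsympLE l (fun i => (h i * X * h i) ^ s) (fun i => h i * X ^ s * h i) := by
  set q := X ^ (1 / 2 : ℝ) with hqdef
  have hh1 : ∀ᶠ i in l, ‖h i‖ ≤ 1 := hh.mono fun i hi => hi.2
  have hqsa : IsSelfAdjoint q := .of_nonneg CFC.rpow_nonneg
  have hqq : q * q = X := by
    rw [hqdef, CFC.rpow_mul_rpow_of_nonneg hX (by norm_num) (by norm_num), add_halves,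
      CFC.rpow_one X]
  have hVn : ∀ᶠ i in l, 0 ≤ q * (h i * h i) * q ∧ ‖q * (h i * h i) * q‖ ≤ ‖X‖ :=
    hh.mono fun i hi => ⟨conj_sq_nonneg hqsa hi.1,
      CStarAlgebra.norm_le_norm_of_nonneg_of_le (conj_sq_nonneg hqsa hi.1)
        (by rw [← hqq]; exact conj_sq_le hqsa hi.1 hi.2)⟩
  have hWn : ∀ᶠ i in l, 0 ≤ h i * X * h i ∧ ‖h i * X * h i‖ ≤ ‖X‖ := hh.mono fun i hi => by
    constructor
    · rw [← hqq]; exact conj_sq_nonneg hi.1 hqsa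
    · calc ‖h i * X * h i‖ ≤ ‖h i‖ * ‖X‖ * ‖h i‖ := norm_mul₃_le
        _ ≤ 1 * ‖X‖ * 1 := by gcongr <;> exact hi.2
        _ = ‖X‖ := by ring
  have hWV : Tendsto (fun i => h i * X * h i - q * (h i * h i) * q) l (𝓝 0) := by
    have := tendsto_mul_sq_mul_sub (q := fun _ => q) (L := ‖q‖) hh1 (by simp) (hcomm q)
    simpa only [hqq] using this
  have step1 : AsympLE l (fun i => (h i * X * h i) ^ s) (fun i => (q * (h i * h i) * q) ^ s) := by
    have := tendsto_cfc_intertwine (b := fun _ => (1 : A)) (K := ‖(1 : A)‖) hWn hVn (by simp)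
      (by simpa using hWV) (f := fun t : ℝ => t ^ s)
      (Real.continuous_rpow_const (by linarith)).continuousOn
    refine .of_tendsto (.of_forall fun i => (IsSelfAdjoint.of_nonneg CFC.rpow_nonneg).sub
      (IsSelfAdjoint.of_nonneg CFC.rpow_nonneg)) (this.congr' ?_)
    filter_upwards [hVn, hWn] with i h1 h2
    rw [CFC.rpow_eq_cfc_real h1.1, CFC.rpow_eq_cfc_real h2.1, mul_one, one_mul]
  -- The assumption `1 ≤ s` enters here: one factor is split off, and `s - 1 ≥ 0` is left for
  -- `asympLE_rpow`.
  have step2 := asympLE_rpow_succ hX hh hcomm (r := s - 1) (by linarith)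
    (asympLE_rpow hX hh hcomm (by linarith))
  rw [sub_add_cancel] at step2
  refine step1.trans (step2.trans ?_)
  have hbsa : IsSelfAdjoint (X ^ (s / 2)) := .of_nonneg CFC.rpow_nonneg
  have h3 := tendsto_mul_sq_mul_sub (p := fun _ => X ^ (s / 2)) (K := ‖X ^ (s / 2)‖) (by simp) hh1
    (by simpa using (hcomm (X ^ (s / 2))).neg)
  refine (AsympLE.of_tendsto (hh.mono fun i hi => ?_) h3).trans (.of_le (.of_forall fun i => ?_))
  · exact (IsSelfAdjoint.of_nonneg (conj_sq_nonneg hbsa hi.1)).sub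
      (IsSelfAdjoint.of_nonneg (conj_sq_nonneg hi.1 hbsa))
  · rw [CFC.rpow_mul_rpow_of_nonneg hX (by linarith) (by linarith), add_halves]

end Rpow

/-! ### Lowering a norm towards its value in the quotient. -/

section NormAdjust

variable {A D : Type*} [CStarAlgebra A] [PartialOrder A] [StarOrderedRing A] [CStarAlgebra D]

theorem mul_self_le_self_of_le_one {u : A} (hu0 : 0 ≤ u) (hu1 : u ≤ 1) : u * u ≤ u := by
  have hsa : IsSelfAdjoint u := .of_nonneg hu0
  have h1sa : IsSelfAdjoint (1 - u) := (IsSelfAdjoint.one A).sub hsa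
  have h1 := star_left_conjugate_nonneg hu0 (1 - u)
  have h2 := star_left_conjugate_nonneg (sub_nonneg.2 hu1) u
  rw [h1sa.star_eq] at h1
  rw [hsa.star_eq] at h2
  rw [← sub_nonneg]
  have : u - u * u = (1 - u) * u * (1 - u) + u * (1 - u) * u := by noncomm_ring
  rw [this]
  exact add_nonneg h1 h2

theorem exists_excess_of_norm_map_le (ρ : A →⋆ₐ[ℂ] D) {T : A} (hT : 0 ≤ T) {m M : ℝ}
    (hmM : m ≤ M) (hρT : ‖ρ T‖ ≤ m) (hTM : ‖T‖ ≤ M) :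
    ∃ b : A, 0 ≤ b ∧ ρ b = 0 ∧ T ≤ algebraMap ℝ A m + b ∧ b ≤ algebraMap ℝ A (M - m) := by
  let _ : PartialOrder D := CStarAlgebra.spectralOrder D
  let _ : StarOrderedRing D := CStarAlgebra.spectralOrderedRing D
  have hsa : IsSelfAdjoint T := .of_nonneg hT
  have hρ0 : 0 ≤ ρ T := map_nonneg ρ hT
  have hc : Continuous fun t : ℝ => max (t - m) 0 := by fun_prop
  -- The excess is `(T - m)₊`; its image is `(ρ T - m)₊ = 0`, because the spectrum of `ρ T` lies
  -- below `m`.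
  refine ⟨cfc (fun t : ℝ => max (t - m) 0) T, cfc_nonneg fun t _ => le_max_right _ _, ?_, ?_, ?_⟩
  · rw [StarAlgHomClass.map_cfc ρ _ T hc.continuousOn ρ.continuous_of_cstarAlgebra hsa
      (.of_nonneg hρ0)]
    rw [← cfc_const_zero ℝ (ρ T)]
    refine cfc_congr fun t ht => ?_
    exact max_eq_right (by linarith [(spectrum_subset_Icc_of_norm_le hρ0 hρT ht).2])
  · nth_rewrite 1 [← cfc_id' ℝ T]
    rw [← cfc_const_add m (fun t : ℝ => max (t - m) 0) T hc.continuousOn]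
    exact cfc_mono fun t _ => by linarith [le_max_left (t - m) 0]
  · refine cfc_le_algebraMap _ _ _ fun t ht => max_le ?_ (by linarith)
    linarith [(spectrum_subset_Icc_of_norm_le hT hTM ht).2]

/-- Write `h = 1 - c u`, `κ = (1 - c)²` and `T ≤ m + b` with `b` in the kernel. Then `m h² ≤ m - m
(1 - κ) u`, while `h b h ≈ κ u b u ≤ m (1 - κ) u` because `b ≤ m / κ - m`. The two terms in `u`
cancel and leave `m`. -/
theorem IsQuasicentralFilter.eventually_norm_conj_le {ρ : A →⋆ₐ[ℂ] D} {l : Filter A}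
    (hl : IsQuasicentralFilter ρ l) {T : A} (hT : 0 ≤ T) {m c : ℝ} (hm : 0 ≤ m)
    (hc0 : 0 < c) (hc1 : c < 1) (hρT : ‖ρ T‖ ≤ m) (hTm : ‖T‖ * (1 - c) ^ 2 ≤ m)
    {m' : ℝ} (hm' : m < m') :
    ∀ᶠ u in l, ‖(1 - c • u) * T * (1 - c • u)‖ ≤ m' := by
  set κ := (1 - c) ^ 2 with hκ
  have hκ0 : 0 < κ := by have : 0 < 1 - c := by linarith
                         positivity
  have hκ1 : κ ≤ 1 := by rw [hκ]; nlinarith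
  obtain ⟨b, hb0, hρb, hTb, hbM⟩ := exists_excess_of_norm_map_le ρ hT
    (M := m / κ) (by rw [le_div_iff₀ hκ0]; nlinarith) hρT (by rwa [le_div_iff₀ hκ0])
  have hbsa : IsSelfAdjoint b := .of_nonneg hb0
  have hub := hl.tendsto_mul b hρb
  have hbu : Tendsto (fun u => b * u) l (𝓝 b) := by
    have := hub.sub (hl.tendsto_commutator b)
    rw [sub_zero] at this
    exact this.congr fun u => by abel
  have hun : ∀ᶠ u in l, ‖u‖ ≤ 1 := hl.mem_ker.mono fun u hu =>
    (CStarAlgebra.norm_le_one_iff_of_nonneg u hu.1).2 hu.2.1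
  have hubu : Tendsto (fun u => u * b * u) l (𝓝 b) := by
    have h1 := tendsto_zero_mul_of_bounded hun (f := fun u => u * b - b)
      (by simpa using hub.sub_const b)
    have := h1.add hbu
    rw [zero_add] at this
    exact this.congr fun u => by noncomm_ring
  have hE : Tendsto (fun u => (1 - c • u) * b * (1 - c • u) - κ • (u * b * u)) l (𝓝 0) := by
    have := ((tendsto_const_nhds (x := b) (f := l)).sub (hub.const_smul c)).sub
      (hbu.const_smul c) |>.add (hubu.const_smul (c * c)) |>.sub (hubu.const_smul κ)
    have h0 : b - c • b - c • b + (c * c) • b - κ • b = 0 := by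
      rw [hκ]; module
    rw [h0] at this
    refine this.congr fun u => ?_
    simp only [sub_mul, mul_sub, one_mul, mul_one, smul_mul_assoc, mul_smul_comm, smul_sub,
      smul_smul]
    abel
  rw [Metric.tendsto_nhds] at hE
  filter_upwards [hl.mem_ker, hE (m' - m) (by linarith)] with u ⟨hu0, hu1, _⟩ hEu
  rw [dist_zero_right] at hEu
  set h := 1 - c • u with hh
  have husa : IsSelfAdjoint u := .of_nonneg hu0
  have hsa : IsSelfAdjoint h := (IsSelfAdjoint.one A).sub ((IsSelfAdjoint.all c).smul husa)
  have huu := mul_self_le_self_of_le_one hu0 hu1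
  have hhh : h * h ≤ 1 - (1 - κ) • u := by
    have e : 1 - (1 - κ) • u - h * h = (c * c) • (u - u * u) := by
      rw [hh, hκ]
      simp only [sub_mul, mul_sub, one_mul, mul_one, smul_mul_assoc, mul_smul_comm]
      module
    rw [← sub_nonneg, e]
    exact smul_nonneg (by positivity) (sub_nonneg.2 huu)
  have h1 : h * T * h ≤ m • (h * h) + h * b * h := by
    have := star_left_conjugate_le_conjugate hTb h
    rw [hsa.star_eq] at this
    refine this.trans_eq ?_
    rw [mul_add, add_mul, Algebra.algebraMap_eq_smul_one, mul_smul_comm, mul_one, smul_mul_assoc]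
  have h2 : κ • (u * b * u) ≤ (m * (1 - κ)) • u := by
    have := star_left_conjugate_le_conjugate hbM u
    rw [husa.star_eq, Algebra.algebraMap_eq_smul_one, mul_smul_comm, mul_one, smul_mul_assoc]
      at this
    have h3 := smul_le_smul_of_nonneg_left this hκ0.le
    rw [smul_smul, show κ * (m / κ - m) = m * (1 - κ) by field_simp] at h3
    exact h3.trans (smul_le_smul_of_nonneg_left huu (mul_nonneg hm (by linarith)))
  have hEsa : IsSelfAdjoint (h * b * h - κ • (u * b * u)) := by
    have i1 := IsSelfAdjoint.of_nonneg (star_left_conjugate_nonneg hb0 h)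
    have i2 := IsSelfAdjoint.of_nonneg (star_left_conjugate_nonneg hb0 u)
    rw [hsa.star_eq] at i1
    rw [husa.star_eq] at i2
    exact i1.sub ((IsSelfAdjoint.all κ).smul i2)
  have h4 : h * T * h ≤ algebraMap ℝ A m' := calc
    h * T * h ≤ m • (h * h) + h * b * h := h1
    _ ≤ m • (1 - (1 - κ) • u) + h * b * h := by
        gcongr
    _ = m • (1 : A) - (m * (1 - κ)) • u + κ • (u * b * u) + (h * b * h - κ • (u * b * u)) := by
        rw [smul_sub, smul_smul]; abel
    _ ≤ m • (1 : A) - (m * (1 - κ)) • u + (m * (1 - κ)) • u + algebraMap ℝ A (m' - m) := by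
        gcongr
        exact hEsa.le_algebraMap_norm_self.trans (algebraMap_mono A hEu.le)
    _ = algebraMap ℝ A m' := by
        rw [sub_add_cancel, ← Algebra.algebraMap_eq_smul_one, ← map_add]; congr 1; ring
  have h5 : 0 ≤ h * T * h := by
    have := star_left_conjugate_nonneg hT h
    rwa [hsa.star_eq] at this
  exact (CStarAlgebra.norm_le_iff_le_algebraMap _ (hm.trans hm'.le) h5).2 h4

end NormAdjust

/-! ### Homogeneous polynomials and their values at `h x`. -/

namespace NCStarPoly

variable {r : ℕ}

/-- The monomial attached to a word in the letters. -/
noncomputable def word : FreeMonoid (Fin r ⊕ Fin r) →* NCStarPoly r :=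
  FreeMonoid.lift (FreeAlgebra.ι ℂ)

/-- The coefficients of a polynomial in the basis of monomials. -/
noncomputable def coeff (p : NCStarPoly r) : FreeMonoid (Fin r ⊕ Fin r) →₀ ℂ :=
  (FreeAlgebra.equivMonoidAlgebraFreeMonoid p).coeff

theorem sum_coeff_smul_word (p : NCStarPoly r) :
    (coeff p).sum (fun w c => c • word w) = p := by
  conv_rhs => rw [← FreeAlgebra.equivMonoidAlgebraFreeMonoid.symm_apply_apply p]
  change _ = MonoidAlgebra.lift ℂ _ _ (FreeMonoid.lift (FreeAlgebra.ι ℂ)) _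
  rw [MonoidAlgebra.lift_apply]
  rfl

theorem scale_word (t : ℝ) (w : FreeMonoid (Fin r ⊕ Fin r)) :
    scale t (word w) = (t : ℂ) ^ w.length • word w := by
  induction w using FreeMonoid.inductionOn' with
  | one => simp
  | of_mul a w ih =>
    have : scale t (word (FreeMonoid.of a)) = (t : ℂ) • word (FreeMonoid.of a) := by
      simp [scale, word]
    rw [map_mul, map_mul, ih, this, FreeMonoid.length_mul, FreeMonoid.length_of, pow_add, pow_one,
      smul_mul_smul_comm]

theorem coeff_add (p q : NCStarPoly r) : coeff (p + q) = coeff p + coeff q := by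
  simp [coeff]

theorem coeff_smul (c : ℂ) (p : NCStarPoly r) : coeff (c • p) = c • coeff p := by
  simp [coeff]

theorem coeff_word (w : FreeMonoid (Fin r ⊕ Fin r)) : coeff (word w) = Finsupp.single w 1 := by
  have : word w = FreeAlgebra.equivMonoidAlgebraFreeMonoid.symm
      (MonoidAlgebra.single w (1 : ℂ)) := by
    change _ = MonoidAlgebra.lift ℂ _ _ (FreeMonoid.lift (FreeAlgebra.ι ℂ)) _
    rw [MonoidAlgebra.lift_single, one_smul]
    rfl
  rw [coeff, this, AlgEquiv.apply_symm_apply, MonoidAlgebra.coeff_single]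

theorem induction_word {motive : NCStarPoly r → Prop} (p : NCStarPoly r) (zero : motive 0)
    (add : ∀ p q, motive p → motive q → motive (p + q))
    (smul_word : ∀ (c : ℂ) w, motive (c • word w)) : motive p := by
  rw [← sum_coeff_smul_word p]
  exact Finset.sum_induction _ motive add zero fun w _ => smul_word _ w

theorem coeff_scale (t : ℝ) (p : NCStarPoly r) (w : FreeMonoid (Fin r ⊕ Fin r)) :
    coeff (scale t p) w = (t : ℂ) ^ w.length * coeff p w := by
  classical
  induction p using induction_word with
  | zero => simp [coeff]
  | add p q hp hq => simp [coeff_add, hp, hq, mul_add]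
  | smul_word c v =>
    rw [map_smul, scale_word, coeff_smul, coeff_smul, coeff_smul, coeff_word]
    simp only [Finsupp.smul_apply, smul_eq_mul, Finsupp.single_apply]
    split_ifs with h
    · subst h; ring
    · simp

/-- The single scalar `t = 2` suffices, since the powers of `2` are distinct. -/
theorem IsHomogeneous.length_eq {p : NCStarPoly r} {d : ℕ} (hp : p.IsHomogeneous d)
    {w : FreeMonoid (Fin r ⊕ Fin r)} (hw : coeff p w ≠ 0) : w.length = d := by
  have h := congrArg (fun q => coeff q w) (hp 2)
  simp only [coeff_scale, coeff_smul, Finsupp.smul_apply, smul_eq_mul] at h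
  have h2 := mul_right_cancel₀ hw h
  norm_cast at h2
  exact Nat.pow_right_injective le_rfl h2

section Eval

variable {A D : Type*} [CStarAlgebra A] [CStarAlgebra D]

/-- The values of the letters at a tuple. -/
def letter (x : Fin r → A) : Fin r ⊕ Fin r → A := Sum.elim x fun k => star (x k)

/-- Evaluation of noncommutative `*`-polynomials at a tuple in a unital C*-algebra. -/
noncomputable def aeval (x : Fin r → A) : NCStarPoly r →ₐ[ℂ] A :=
  FreeAlgebra.lift ℂ (letter x)

theorem map_aeval (ρ : A →⋆ₐ[ℂ] D) (x : Fin r → A) (p : NCStarPoly r) :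
    ρ (aeval x p) = aeval (fun k => ρ (x k)) p := by
  have : (ρ : A →ₐ[ℂ] D).comp (aeval x) = aeval fun k => ρ (x k) := by
    ext i
    rcases i with k | k <;> simp [aeval, letter, map_star]
  exact DFunLike.congr_fun this p

theorem continuous_aeval (p : NCStarPoly r) : Continuous fun x : Fin r → A => aeval x p := by
  induction p using FreeAlgebra.induction with
  | grade0 c => simpa using continuous_const
  | grade1 i =>
    rcases i with k | k
    · simpa [aeval, letter] using continuous_apply k
    · simpa [aeval, letter] using (continuous_apply k).star
  | mul p q hp hq => simpa only [map_mul] using! hp.mul hq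
  | add p q hp hq => simpa only [map_add] using! hp.add hq

theorem aeval_word (x : Fin r → A) (w : FreeMonoid (Fin r ⊕ Fin r)) :
    aeval x (word w) = FreeMonoid.lift (letter x) w := by
  have : ((aeval x : NCStarPoly r →* A)).comp word = FreeMonoid.lift (letter x) := by
    ext i
    simp [aeval, word]
  exact DFunLike.congr_fun this w

variable {ι : Type*} {l : Filter ι} {h : ι → A}

theorem tendsto_letter (hh : ∀ᶠ i in l, IsSelfAdjoint (h i))
    (hcomm : ∀ a, Tendsto (fun i => h i * a - a * h i) l (𝓝 0)) (x : Fin r → A)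
    (a : Fin r ⊕ Fin r) :
    Tendsto (fun i => letter (fun k => h i * x k) a - h i * letter x a) l (𝓝 0) := by
  rcases a with k | k
  · simpa [letter] using tendsto_const_nhds
  · have := (hcomm (star (x k))).neg
    rw [neg_zero] at this
    refine this.congr' (hh.mono fun i hi => ?_)
    simp [letter, hi.star_eq]

theorem tendsto_commutator_pow (hh1 : ∀ᶠ i in l, ‖h i‖ ≤ 1)
    (hcomm : ∀ a, Tendsto (fun i => h i * a - a * h i) l (𝓝 0)) (n : ℕ) (a : A) :
    Tendsto (fun i => h i ^ n * a - a * h i ^ n) l (𝓝 0) := by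
  simpa using tendsto_aeval_intertwine (b := fun _ => a) hh1 hh1 (hcomm a) (Polynomial.X ^ n)

theorem eventually_norm_pow_le (hh1 : ∀ᶠ i in l, ‖h i‖ ≤ 1) (n : ℕ) :
    ∀ᶠ i in l, ‖h i ^ n‖ ≤ 1 := by
  rcases subsingleton_or_nontrivial A with hA | hA
  · exact .of_forall fun i => by simp [Subsingleton.elim (h i ^ n) 0]
  · exact hh1.mono fun i hi => (norm_pow_le _ _).trans (pow_le_one₀ (norm_nonneg _) hi)

/-- Each letter contributes one factor `h`, also the starred ones because `(h x)* = x* h ≈ h x*`;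
asymptotic centrality moves all of them to the front. -/
theorem tendsto_aeval_word (hh : ∀ᶠ i in l, IsSelfAdjoint (h i)) (hh1 : ∀ᶠ i in l, ‖h i‖ ≤ 1)
    (hcomm : ∀ a, Tendsto (fun i => h i * a - a * h i) l (𝓝 0)) (x : Fin r → A)
    (w : FreeMonoid (Fin r ⊕ Fin r)) :
    Tendsto (fun i => aeval (fun k => h i * x k) (word w) - h i ^ w.length * aeval x (word w)) l
      (𝓝 0) := by
  simp only [aeval_word]
  induction w using FreeMonoid.inductionOn' with
  | one => simpa using tendsto_const_nhds
  | of_mul a w ih =>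
    simp only [map_mul, FreeMonoid.lift_eval_of, FreeMonoid.length_mul, FreeMonoid.length_of]
    set y := letter x a
    set Y := FreeMonoid.lift (letter x) w
    have hY : ∀ᶠ i in l, ‖FreeMonoid.lift (letter fun k => h i * x k) w‖ ≤ 1 + ‖Y‖ := by
      have h1 := (Metric.tendsto_nhds.1 ih) 1 one_pos
      filter_upwards [h1, eventually_norm_pow_le hh1 w.length] with i hi hn
      rw [dist_zero_right] at hi
      have h2 := norm_sub_norm_le (FreeMonoid.lift (letter fun k => h i * x k) w)
        (h i ^ w.length * Y)
      have h3 : ‖h i ^ w.length * Y‖ ≤ 1 * ‖Y‖ := (norm_mul_le _ _).trans (by gcongr)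
      linarith
    have e1 := tendsto_zero_mul_of_bounded hY (tendsto_letter hh hcomm x a)
    have hb : ∀ᶠ i in l, ‖h i * y‖ ≤ 1 * ‖y‖ := eventually_norm_mul_le hh1 (by simp)
    have e2 := tendsto_mul_zero_of_bounded hb ih
    have e0 := (tendsto_commutator_pow hh1 hcomm w.length y).neg.mul_const Y
    rw [neg_zero, zero_mul] at e0
    have := (e1.add e2).add (tendsto_mul_zero_of_bounded hh1 e0)
    rw [add_zero, add_zero] at this
    refine this.congr fun i => ?_
    rw [pow_add, pow_one]
    noncomm_ring

theorem IsHomogeneous.tendsto_aeval {p : NCStarPoly r} {d : ℕ} (hp : p.IsHomogeneous d)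
    (hh : ∀ᶠ i in l, IsSelfAdjoint (h i)) (hh1 : ∀ᶠ i in l, ‖h i‖ ≤ 1)
    (hcomm : ∀ a, Tendsto (fun i => h i * a - a * h i) l (𝓝 0)) (x : Fin r → A) :
    Tendsto (fun i => aeval (fun k => h i * x k) p - h i ^ d * aeval x p) l (𝓝 0) := by
  have key : Tendsto (fun i => ∑ w ∈ (coeff p).support, coeff p w •
      (aeval (fun k => h i * x k) (word w) - h i ^ w.length * aeval x (word w))) l (𝓝 0) := by
    have := tendsto_finsetSum (coeff p).support fun w _ =>
      (tendsto_aeval_word hh hh1 hcomm x w).const_smul (coeff p w)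
    simpa using this
  refine key.congr fun i => ?_
  have e : ∀ z : Fin r → A, aeval z p = ∑ w ∈ (coeff p).support, coeff p w • aeval z (word w) := by
    intro z
    conv_lhs => rw [← sum_coeff_smul_word p]
    rw [Finsupp.sum, map_sum]
    simp only [map_smul]
  rw [e, e x, Finset.mul_sum, ← Finset.sum_sub_distrib]
  refine Finset.sum_congr rfl fun w hw => ?_
  rw [hp.length_eq (Finsupp.mem_support_iff.1 hw), smul_sub, mul_smul_comm]

end Eval

end NCStarPoly

/-! ### Improving approximate lifts and passing to the limit. -/

section Lifting

variable {r J : ℕ} {A D : Type*} [CStarAlgebra A] [CStarAlgebra D]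

/-- The relations `‖∑ₖ (xₖ xₖ*)^s‖ ≤ (1 + ε)^2` and `‖pⱼ(x)‖ ≤ (1 + ε) Cⱼ` in a unital
C*-algebra. -/
structure RelaxedRelations (s : ℝ) (p : Fin J → NCStarPoly r) (C : Fin J → ℝ) (ε : ℝ)
    (x : Fin r → A) : Prop where
  ball : ‖∑ k, cfc (fun t : ℝ => t ^ s) (x k * star (x k))‖ ≤ (1 + ε) ^ 2
  poly : ∀ j, ‖NCStarPoly.aeval x (p j)‖ ≤ (1 + ε) * C j

theorem StarAlgHom.map_sum_cfc_rpow (ρ : A →⋆ₐ[ℂ] D) {s : ℝ} (hs : 0 ≤ s) (x : Fin r → A) :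
    ρ (∑ k, cfc (fun t : ℝ => t ^ s) (x k * star (x k)))
      = ∑ k, cfc (fun t : ℝ => t ^ s) (ρ (x k) * star (ρ (x k))) := by
  rw [map_sum]
  refine Finset.sum_congr rfl fun k _ => ?_
  rw [StarAlgHomClass.map_cfc ρ _ _ (Real.continuous_rpow_const hs).continuousOn
    ρ.continuous_of_cstarAlgebra (.mul_star_self _)
    (by rw [map_mul, map_star]; exact .mul_star_self _), map_mul, map_star]

variable [PartialOrder A] [StarOrderedRing A] {ρ : A →⋆ₐ[ℂ] D} {s : ℝ} {p : Fin J → NCStarPoly r}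
  {d : Fin J → ℕ} {C : Fin J → ℝ}

theorem IsQuasicentralFilter.eventually_conj {l : Filter A} (hl : IsQuasicentralFilter ρ l) {c : ℝ}
    (hc0 : 0 < c) (hc1 : c < 1) :
    (∀ᶠ u in l, IsSelfAdjoint (1 - c • u) ∧ ‖1 - c • u‖ ≤ 1) ∧
      ∀ a, Tendsto (fun u => (1 - c • u) * a - a * (1 - c • u)) l (𝓝 0) := by
  constructor
  · filter_upwards [hl.mem_ker] with u ⟨hu0, hu1, _⟩
    have hcu : 0 ≤ c • u := smul_nonneg hc0.le hu0
    have hcu1 : c • u ≤ 1 := by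
      calc c • u ≤ c • (1 : A) := smul_le_smul_of_nonneg_left hu1 hc0.le
        _ ≤ (1 : ℝ) • (1 : A) := smul_le_smul_of_nonneg_right hc1.le zero_le_one
        _ = 1 := one_smul _ _
    have h0 : 0 ≤ 1 - c • u := sub_nonneg.2 hcu1
    exact ⟨.of_nonneg h0, (CStarAlgebra.norm_le_one_iff_of_nonneg _ h0).2 (sub_le_self _ hcu)⟩
  · intro a
    have := (hl.tendsto_commutator a).const_smul (-c)
    rw [smul_zero] at this
    refine this.congr fun u => ?_
    simp only [sub_mul, mul_sub, one_mul, mul_one, smul_mul_assoc, mul_smul_comm, neg_smul,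
      smul_sub]
    abel

theorem eventually_ball_le {l : Filter A} (hl : IsQuasicentralFilter ρ l) (hs : 1 ≤ s)
    {x : Fin r → A} (hρ : ‖∑ k, cfc (fun t : ℝ => t ^ s) (ρ (x k) * star (ρ (x k)))‖ ≤ 1)
    {c m : ℝ} (hc0 : 0 < c) (hc1 : c < 1) (hm : 1 < m)
    (hx : ‖∑ k, cfc (fun t : ℝ => t ^ s) (x k * star (x k))‖ * (1 - c) ^ 2 ≤ 1) :
    ∀ᶠ u in l, ‖∑ k, cfc (fun t : ℝ => t ^ s)
      (((1 - c • u) * x k) * star ((1 - c • u) * x k))‖ ≤ m := by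
  have hs0 : 0 ≤ s := by linarith
  obtain ⟨hh, hcomm⟩ := hl.eventually_conj hc0 hc1
  have hX : ∀ k, 0 ≤ x k * star (x k) := fun k => mul_star_self_nonneg _
  set S := ∑ k, cfc (fun t : ℝ => t ^ s) (x k * star (x k)) with hS
  have hS0 : 0 ≤ S := Finset.sum_nonneg fun k _ => cfc_nonneg fun t ht =>
    Real.rpow_nonneg (spectrum_nonneg_of_nonneg (hX k) ht) _
  have h1 := hl.eventually_norm_conj_le hS0 zero_le_one hc0 hc1
    (by rw [hS, ρ.map_sum_cfc_rpow hs0]; exact hρ) hx (m' := (1 + m) / 2) (by linarith)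
  -- The compression inequality reduces the sum of powers to `h S h`; the slack `m - 1` is shared
  -- equally between this error and the bound on `h S h`.
  have h2 := AsympLE.sum Finset.univ fun k _ => asympLE_conj_rpow (hX k) hh hcomm hs
  filter_upwards [hh, h1, h2 ((m - 1) / 2) (by linarith)] with u ⟨hsa, hn⟩ hu1 hu2
  set h := 1 - c • u with hh
  have e1 : ∀ k, (h * x k) * star (h * x k) = h * (x k * star (x k)) * h := fun k => by
    rw [star_mul, hsa.star_eq]; noncomm_ring
  have hW : ∀ k, 0 ≤ h * (x k * star (x k)) * h := fun k => by
    rw [← e1]; exact mul_star_self_nonneg _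
  have e2 : ∀ k, cfc (fun t : ℝ => t ^ s) ((h * x k) * star (h * x k))
      = (h * (x k * star (x k)) * h) ^ s := fun k => by
    rw [e1, CFC.rpow_eq_cfc_real (hW k)]
  have e3 : ∑ k, h * (x k * star (x k)) ^ s * h = h * S * h := by
    rw [hS, Finset.mul_sum, Finset.sum_mul]
    exact Finset.sum_congr rfl fun k _ => by rw [CFC.rpow_eq_cfc_real (hX k)]
  rw [e3] at hu2
  simp only [e2]
  have hpos : 0 ≤ ∑ k, (h * (x k * star (x k)) * h) ^ s :=
    Finset.sum_nonneg fun k _ => CFC.rpow_nonneg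
  have hS' : 0 ≤ h * S * h := by
    simpa [hsa.star_eq] using star_left_conjugate_nonneg hS0 h
  rw [CStarAlgebra.norm_le_iff_le_algebraMap _ (by linarith) hpos]
  calc ∑ k, (h * (x k * star (x k)) * h) ^ s ≤ h * S * h + algebraMap ℝ A ((m - 1) / 2) := hu2
    _ ≤ algebraMap ℝ A ((1 + m) / 2) + algebraMap ℝ A ((m - 1) / 2) := by
        gcongr
        exact (CStarAlgebra.norm_le_iff_le_algebraMap _ (by linarith) hS').1 hu1
    _ = algebraMap ℝ A m := by rw [← map_add]; congr 1; ring

theorem eventually_poly_le {l : Filter A} (hl : IsQuasicentralFilter ρ l) {p : NCStarPoly r} {d : ℕ}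
    (hd : 1 ≤ d) (hp : p.IsHomogeneous d) {x : Fin r → A} {C : ℝ} (hC : 0 ≤ C)
    (hρ : ‖NCStarPoly.aeval (fun k => ρ (x k)) p‖ ≤ C)
    {c C' : ℝ} (hc0 : 0 < c) (hc1 : c < 1) (hC' : C < C')
    (hx : ‖NCStarPoly.aeval x p‖ * (1 - c) ≤ C) :
    ∀ᶠ u in l, ‖NCStarPoly.aeval (fun k => (1 - c • u) * x k) p‖ ≤ C' := by
  obtain ⟨hh, hcomm⟩ := hl.eventually_conj hc0 hc1
  set P := NCStarPoly.aeval x p with hP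
  have h1 := hl.eventually_norm_conj_le (mul_star_self_nonneg P) (m := C ^ 2) (sq_nonneg C) hc0 hc1
    (by rw [map_mul, map_star, CStarRing.norm_self_mul_star, ← sq, hP, NCStarPoly.map_aeval]
        gcongr)
    (by rw [CStarRing.norm_self_mul_star, ← sq, ← mul_pow]
        have : 0 ≤ 1 - c := by linarith
        gcongr)
    (m' := ((C + C') / 2) ^ 2) (by gcongr; linarith)
  have h2 := Metric.tendsto_nhds.1
    (hp.tendsto_aeval (hh.mono fun i hi => hi.1) (hh.mono fun i hi => hi.2) hcomm x)
    ((C' - C) / 2) (by linarith)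
  filter_upwards [hh, h1, h2, NCStarPoly.eventually_norm_pow_le (hh.mono fun i hi => hi.2) (d - 1)]
    with u ⟨hsa, hn⟩ hu1 hu2 hu3
  rw [dist_zero_right] at hu2
  set h := 1 - c • u with hh
  have e1 : ‖h * P‖ ≤ (C + C') / 2 := by
    have : h * (P * star P) * h = (h * P) * star (h * P) := by
      rw [star_mul, hsa.star_eq]; noncomm_ring
    rw [this, CStarRing.norm_self_mul_star, ← sq] at hu1
    exact (abs_le_of_sq_le_sq' hu1 (by linarith)).2
  -- Positive degree is needed here: at least one factor `h` must remain to do the shrinking, and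
  -- the other `d - 1` are contractions.
  have e2 : ‖h ^ d * P‖ ≤ ‖h * P‖ := by
    have : h ^ d * P = h ^ (d - 1) * (h * P) := by
      rw [← mul_assoc, ← pow_succ, Nat.sub_add_cancel hd]
    rw [this]
    refine (norm_mul_le _ _).trans ?_
    nlinarith [norm_nonneg (h * P)]
  have := norm_sub_norm_le (NCStarPoly.aeval (fun k => h * x k) p) (h ^ d * P)
  linarith

theorem RelaxedRelations.exists_improve (hs : 1 ≤ s) (hd : ∀ j, 1 ≤ d j)
    (hp : ∀ j, (p j).IsHomogeneous (d j)) (hC : ∀ j, 0 < C j) {y : Fin r → D}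
    (hy : RelaxedRelations s p C 0 y) {x : Fin r → A} (hxy : ∀ k, ρ (x k) = y k) {ε ε' : ℝ}
    (hε : 0 < ε) (hε' : 0 < ε') (hx : RelaxedRelations s p C ε x) :
    ∃ x' : Fin r → A, (∀ k, ρ (x' k) = y k) ∧ RelaxedRelations s p C ε' x' ∧
      ∀ k, ‖x' k‖ ≤ ‖x k‖ ∧ ‖x' k - x k‖ ≤ ε * ‖x k‖ := by
  obtain ⟨l, hne, hl⟩ := exists_isQuasicentralFilter ρ
  obtain rfl : (fun k => ρ (x k)) = y := funext hxy
  -- This `c` solves `(1 + ε) (1 - c) = 1`, and `c ≤ ε` bounds the displacement. The target `ε'`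
  -- does not affect it, only how far out `u` is taken.
  set c := ε / (1 + ε) with hc
  have hc0 : 0 < c := by positivity
  have hc1 : c < 1 := by rw [hc, div_lt_one (by positivity)]; linarith
  have hcε : c ≤ ε := by rw [hc]; exact div_le_self hε.le (by linarith)
  have h1c : (1 + ε) * (1 - c) = 1 := by rw [hc]; field_simp; ring
  have h1c0 : 0 < 1 - c := by linarith
  have hball := eventually_ball_le hl hs (x := x) (by simpa using hy.ball) hc0 hc1
    (m := (1 + ε') ^ 2) (by nlinarith) (by
      calc _ ≤ (1 + ε) ^ 2 * (1 - c) ^ 2 := by gcongr; exact hx.ball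
        _ = 1 := by rw [← mul_pow, h1c, one_pow])
  have hpoly : ∀ j, ∀ᶠ u in l,
      ‖NCStarPoly.aeval (fun k => (1 - c • u) * x k) (p j)‖ ≤ (1 + ε') * C j := fun j =>
    eventually_poly_le hl (hd j) (hp j) (hC j).le (by simpa using hy.poly j) hc0 hc1
      (by nlinarith [hC j]) (by
        calc _ ≤ (1 + ε) * C j * (1 - c) := by gcongr; exact hx.poly j
          _ = C j := by rw [mul_right_comm, h1c, one_mul])
  obtain ⟨u, hb, hpl, ⟨hu0, hu1, hρu⟩, -, hn⟩ := (hball.and ((eventually_all.2 hpoly).and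
    (hl.mem_ker.and (hl.eventually_conj hc0 hc1).1))).exists
  refine ⟨fun k => (1 - c • u) * x k, fun k => ?_, ⟨hb, hpl⟩, fun k => ⟨?_, ?_⟩⟩
  · rw [map_mul, map_sub, ρ.map_real_smul_eq_zero c hρu, map_one, sub_zero, one_mul]
  · exact (norm_mul_le _ _).trans (by nlinarith [norm_nonneg (x k)])
  · have : (1 - c • u) * x k - x k = -(c • (u * x k)) := by
      rw [sub_mul, one_mul, smul_mul_assoc]; abel
    rw [this, norm_neg, norm_smul, Real.norm_of_nonneg hc0.le]
    have hun := (CStarAlgebra.norm_le_one_iff_of_nonneg u hu0).2 hu1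
    have := norm_mul_le u (x k)
    have : ‖u * x k‖ ≤ ‖x k‖ := by nlinarith [norm_nonneg (x k)]
    gcongr

/-- The uniform bound `K` puts all spectra of `x x*` in one compact interval, where the functional
calculus is continuous in the element. -/
theorem RelaxedRelations.of_tendsto (hs : 1 ≤ s) {f : ℕ → Fin r → A} {z : Fin r → A} {e : ℕ → ℝ}
    {K : ℝ} (hK : ∀ n k, ‖f n k‖ ≤ K) (hf : Tendsto f atTop (𝓝 z)) (he : Tendsto e atTop (𝓝 0))
    (h : ∀ n, RelaxedRelations s p C (e n) (f n)) : RelaxedRelations s p C 0 z := by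
  constructor
  · have hlim : Tendsto (fun n => ∑ k, cfc (fun t : ℝ => t ^ s) (f n k * star (f n k))) atTop
        (𝓝 (∑ k, cfc (fun t : ℝ => t ^ s) (z k * star (z k)))) := by
      refine tendsto_finsetSum _ fun k _ => ?_
      have hfk := (tendsto_pi_nhds.1 hf) k
      have hzK : ‖z k‖ ≤ K := le_of_tendsto hfk.norm (.of_forall fun n => hK n k)
      have hsp : ∀ a : A, ‖a‖ ≤ K → spectrum ℝ (a * star a) ⊆ Set.Icc 0 (K * K) := fun a ha =>
        spectrum_subset_Icc_of_norm_le (mul_star_self_nonneg a) (by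
          rw [CStarRing.norm_self_mul_star]
          exact mul_self_le_mul_self (norm_nonneg _) ha)
      exact (hfk.mul hfk.star).cfc (isCompact_Icc (a := 0) (b := K * K)) (fun t : ℝ => t ^ s)
        (.of_forall fun n => hsp _ (hK n k)) (.of_forall fun n => .mul_star_self _)
        (hsp _ hzK) (.mul_star_self _) (Real.continuous_rpow_const (by linarith)).continuousOn
    exact le_of_tendsto_of_tendsto' hlim.norm ((he.const_add 1).pow 2) fun n => (h n).ball
  · intro j
    have hlim := ((NCStarPoly.continuous_aeval (A := A) (p j)).tendsto z).comp hf
    exact le_of_tendsto_of_tendsto' hlim.norm ((he.const_add 1).mul_const (C j))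
      fun n => (h n).poly j

theorem RelaxedRelations.exists_lift (hs : 1 ≤ s) (hd : ∀ j, 1 ≤ d j)
    (hp : ∀ j, (p j).IsHomogeneous (d j)) (hC : ∀ j, 0 < C j) {y : Fin r → D}
    (hy : RelaxedRelations s p C 0 y) {x : Fin r → A} (hxy : ∀ k, ρ (x k) = y k) :
    ∃ z : Fin r → A, (∀ k, ρ (z k) = y k) ∧ RelaxedRelations s p C 0 z := by
  -- Any lift is admissible for a large enough `ε`; dividing by `C j > 0` makes one `ε` serve all
  -- polynomials.
  obtain ⟨ε, hε, hx⟩ : ∃ ε : ℝ, 0 < ε ∧ RelaxedRelations s p C ε x := by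
    set b := ‖∑ k, cfc (fun t : ℝ => t ^ s) (x k * star (x k))‖
    set g : Fin J → ℝ := fun j => ‖NCStarPoly.aeval x (p j)‖ / C j with hg
    have hg0 : ∀ j, 0 ≤ g j := fun j => div_nonneg (norm_nonneg _) (hC j).le
    have hb0 : 0 ≤ b := norm_nonneg _
    have hsum0 : 0 ≤ ∑ j, g j := Finset.sum_nonneg fun j _ => hg0 j
    refine ⟨1 + b + ∑ j, g j, by positivity, ?_, fun j => ?_⟩
    · change b ≤ _
      nlinarith
    · have : g j ≤ ∑ j, g j := Finset.single_le_sum (fun j _ => hg0 j) (Finset.mem_univ j)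
      rw [← div_le_iff₀ (hC j)]
      change g j ≤ _
      linarith
  set K := ‖x‖ with hK
  have hstep : ∀ n : ℕ, ∀ a : {a : Fin r → A // (∀ k, ρ (a k) = y k) ∧
      RelaxedRelations s p C (ε / 2 ^ n) a ∧ ∀ k, ‖a k‖ ≤ K},
      ∃ b : {a : Fin r → A // (∀ k, ρ (a k) = y k) ∧
        RelaxedRelations s p C (ε / 2 ^ (n + 1)) a ∧ ∀ k, ‖a k‖ ≤ K},
        dist a.1 b.1 ≤ ε * K * (1 / 2) ^ n := by
    rintro n ⟨a, ha1, ha2, ha3⟩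
    obtain ⟨b, hb1, hb2, hb3⟩ := RelaxedRelations.exists_improve hs hd hp hC hy ha1
      (ε := ε / 2 ^ n) (ε' := ε / 2 ^ (n + 1)) (by positivity) (by positivity) ha2
    refine ⟨⟨b, hb1, hb2, fun k => (hb3 k).1.trans (ha3 k)⟩, ?_⟩
    rw [dist_comm]
    refine (dist_pi_le_iff (by positivity)).2 fun k => ?_
    rw [dist_eq_norm]
    refine (hb3 k).2.trans ?_
    calc ε / 2 ^ n * ‖a k‖ ≤ ε / 2 ^ n * K := by gcongr; exact ha3 k
      _ = ε * K * (1 / 2) ^ n := by rw [one_div, inv_pow]; ring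
  choose next hnext using hstep
  let F : ∀ n : ℕ, {a : Fin r → A // (∀ k, ρ (a k) = y k) ∧
      RelaxedRelations s p C (ε / 2 ^ n) a ∧ ∀ k, ‖a k‖ ≤ K} := fun n =>
    Nat.rec ⟨x, hxy, by simpa using hx, norm_le_pi_norm x⟩ (fun n a => next n a) n
  have hF : ∀ n, dist (F n).1 (F (n + 1)).1 ≤ ε * K * (1 / 2) ^ n := fun n => hnext n (F n)
  obtain ⟨z, hz⟩ := cauchySeq_tendsto_of_complete
    (cauchySeq_of_le_geometric (1 / 2) (ε * K) (by norm_num) hF)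
  refine ⟨z, fun k => ?_, RelaxedRelations.of_tendsto hs (fun n => (F n).2.2.2) hz ?_
    fun n => (F n).2.2.1⟩
  · have h1 := ((ρ.continuous_of_cstarAlgebra).tendsto (z k)).comp ((tendsto_pi_nhds.1 hz) k)
    exact tendsto_nhds_unique h1 (tendsto_const_nhds.congr fun n => ((F n).2.1 k).symm)
  · have := (tendsto_pow_atTop_nhds_zero_of_lt_one (r := (1 / 2 : ℝ)) (by norm_num)
      (by norm_num)).const_mul ε
    rw [mul_zero] at this
    exact this.congr fun n => by rw [one_div, inv_pow]; ring

end Lifting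

/-! ### Transfer between an algebra and its unitization, and permanence of the relations. -/

section Evaluation

variable {r J : ℕ} {A B : Type u} [NonUnitalCStarAlgebra A] [NonUnitalCStarAlgebra B]

namespace NCStarPoly

theorem eval_eq_aeval (x : Fin r → A) (p : NCStarPoly r) :
    eval x p = aeval (fun k => (x k : Unitization ℂ A)) p := by
  simp only [eval, aeval, letter, Unitization.inr_star]

theorem starMap_eval (φ : A →⋆ₙₐ[ℂ] B) (x : Fin r → A) (p : NCStarPoly r) :
    Unitization.starMap φ (eval x p) = eval (fun k => φ (x k)) p := by
  simp only [eval_eq_aeval, map_aeval, Unitization.starMap_inr]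

theorem eval_ι_mem_range_inr (x : Fin r → A) (i : Fin r ⊕ Fin r) :
    ∃ a : A, eval x (FreeAlgebra.ι ℂ i) = a := by
  rcases i with k | k
  · exact ⟨x k, by simp [eval]⟩
  · exact ⟨star (x k), by simp [eval]⟩

/-- Setting all letters to `0` kills `p` but leaves the scalar part of its value unchanged, because
letters take values with scalar part `0`. -/
theorem IsHomogeneous.exists_eval_eq_inr {p : NCStarPoly r} {d : ℕ} (hd : 1 ≤ d)
    (hp : p.IsHomogeneous d) (x : Fin r → A) : ∃ a : A, eval x p = a := by
  have h0 : scale 0 p = 0 := by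
    rw [hp 0, Complex.ofReal_zero, zero_pow (by omega), zero_smul]
  have h1 : ((Unitization.fstHom ℂ A).comp (eval x)).comp (scale 0)
      = (Unitization.fstHom ℂ A).comp (eval x) := by
    ext i
    obtain ⟨a, ha⟩ := eval_ι_mem_range_inr x i
    simp [scale, ha]
  have h2 : (eval x p).fst = 0 := by
    have := DFunLike.congr_fun h1 p
    simpa [h0] using this.symm
  refine ⟨(eval x p).snd, ?_⟩
  ext
  · simpa using h2
  · simp

end NCStarPoly

theorem norm_sum_cfcₙ_rpow {s : ℝ} (hs : 0 < s) (x : Fin r → A) :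
    ‖∑ k, cfc (fun t : ℝ => t ^ s)
        ((x k : Unitization ℂ A) * star (x k : Unitization ℂ A))‖
      = ‖∑ k, cfcₙ (fun t : ℝ => t ^ s) (x k * star (x k))‖ := by
  have hc : Continuous fun t : ℝ => t ^ s := Real.continuous_rpow_const hs.le
  rw [← Unitization.norm_inr (𝕜 := ℂ) (∑ k, cfcₙ (fun t : ℝ => t ^ s) (x k * star (x k)))]
  congr 1
  rw [← Unitization.inrNonUnitalStarAlgHom_apply, map_sum]
  refine Finset.sum_congr rfl fun k _ => ?_
  rw [NonUnitalStarAlgHomClass.map_cfcₙ (Unitization.inrNonUnitalStarAlgHom ℂ A) _ _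
    hc.continuousOn (Real.zero_rpow hs.ne') (Unitization.isometry_inr (𝕜 := ℂ)).continuous
    (.mul_star_self _) (by rw [map_mul, map_star]; exact .mul_star_self _),
    cfcₙ_eq_cfc hc.continuousOn (Real.zero_rpow hs.ne'), map_mul, map_star,
    Unitization.inrNonUnitalStarAlgHom_apply]

variable {q : ℝ} {p : Fin J → NCStarPoly r} {C : Fin J → ℝ} {d : Fin J → ℕ}

theorem ncBallRelations_iff_relaxedRelations (hq : 0 < q) {x : Fin r → A} :
    NCBallRelations q p C A x
      ↔ RelaxedRelations (q / 2) p C 0 fun k => (x k : Unitization ℂ A) := by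
  constructor
  · rintro ⟨h1, h2⟩
    refine ⟨?_, fun j => ?_⟩
    · rw [norm_sum_cfcₙ_rpow (by positivity)]; simpa using h1
    · simpa [NCStarPoly.eval_eq_aeval] using h2 j
  · rintro ⟨h1, h2⟩
    rw [norm_sum_cfcₙ_rpow (by positivity)] at h1
    exact ⟨by simpa using h1, fun j => by simpa [NCStarPoly.eval_eq_aeval] using h2 j⟩

theorem map_sum_cfcₙ_rpow (φ : A →⋆ₙₐ[ℂ] B) {s : ℝ} (hs : 0 < s) (x : Fin r → A) :
    φ (∑ k, cfcₙ (fun t : ℝ => t ^ s) (x k * star (x k)))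
      = ∑ k, cfcₙ (fun t : ℝ => t ^ s) (φ (x k) * star (φ (x k))) := by
  rw [map_sum]
  refine Finset.sum_congr rfl fun k _ => ?_
  have hφ : Continuous φ := AddMonoidHomClass.continuous_of_bound φ 1 fun a => by
    simpa using NonUnitalStarAlgHom.norm_apply_le φ a
  rw [NonUnitalStarAlgHomClass.map_cfcₙ φ _ _ (Real.continuous_rpow_const hs.le).continuousOn
    (Real.zero_rpow hs.ne') hφ
    (.mul_star_self _) (by rw [map_mul, map_star]; exact .mul_star_self _), map_mul, map_star]

theorem NCBallRelations.map (hq : 0 < q) {x : Fin r → A} (hx : NCBallRelations q p C A x)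
    (φ : A →⋆ₙₐ[ℂ] B) : NCBallRelations q p C B fun k => φ (x k) := by
  refine ⟨?_, fun j => ?_⟩
  · rw [← map_sum_cfcₙ_rpow φ (by positivity)]
    exact (NonUnitalStarAlgHom.norm_apply_le φ _).trans hx.ball
  · rw [← NCStarPoly.starMap_eval]
    exact (NonUnitalStarAlgHom.norm_apply_le (Unitization.starMap φ) _).trans (hx.poly j)

/-- This serves both for the coordinates of an `ℓ^∞`-product and for the inclusion of a subalgebra.
Homogeneity ensures that the values of the `p j` lie in `A` itself, where the `φ i` determine the
norm. -/
theorem NCBallRelations.of_jointly_isometric {ι : Type*} {B : ι → Type u}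
    [∀ i, NonUnitalCStarAlgebra (B i)] (φ : ∀ i, A →⋆ₙₐ[ℂ] B i)
    (hφ : ∀ (a : A) (M : ℝ), 0 ≤ M → (∀ i, ‖φ i a‖ ≤ M) → ‖a‖ ≤ M) (hq : 0 < q)
    (hd : ∀ j, 1 ≤ d j) (hp : ∀ j, (p j).IsHomogeneous (d j)) (hC : ∀ j, 0 < C j) {x : Fin r → A}
    (hx : ∀ i, NCBallRelations q p C (B i) fun k => φ i (x k)) : NCBallRelations q p C A x := by
  refine ⟨hφ _ _ zero_le_one fun i => ?_, fun j => ?_⟩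
  · rw [map_sum_cfcₙ_rpow (φ i) (by positivity)]
    exact (hx i).ball
  · obtain ⟨a, ha⟩ := (hp j).exists_eval_eq_inr (hd j) x
    rw [ha, Unitization.norm_inr]
    refine hφ _ _ (hC j).le fun i => ?_
    have := (hx i).poly j
    rwa [← NCStarPoly.starMap_eval, ha, Unitization.starMap_inr, Unitization.norm_inr] at this

theorem NCBallRelations.norm_le_one (hq : 0 < q) {x : Fin r → A} (hx : NCBallRelations q p C A x)
    (k : Fin r) : ‖x k‖ ≤ 1 := by
  let _ : PartialOrder (Unitization ℂ A) := CStarAlgebra.spectralOrder _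
  let _ : StarOrderedRing (Unitization ℂ A) := CStarAlgebra.spectralOrderedRing _
  have h := hx.ball
  rw [← norm_sum_cfcₙ_rpow (by positivity)] at h
  set X : Fin r → Unitization ℂ A := fun k =>
    (x k : Unitization ℂ A) * star (x k : Unitization ℂ A)
  have hX : ∀ k, 0 ≤ X k := fun k => mul_star_self_nonneg _
  have hpos : ∀ k, 0 ≤ cfc (fun t : ℝ => t ^ (q / 2)) (X k) := fun k =>
    cfc_nonneg fun t ht => Real.rpow_nonneg (spectrum_nonneg_of_nonneg (hX k) ht) _
  have h1 : ‖X k ^ (q / 2)‖ ≤ 1 := by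
    rw [CFC.rpow_eq_cfc_real (hX k)]
    exact (CStarAlgebra.norm_le_norm_of_nonneg_of_le (hpos k)
      (Finset.single_le_sum (f := fun k => cfc (fun t : ℝ => t ^ (q / 2)) (X k))
        (fun k _ => hpos k) (Finset.mem_univ k))).trans h
  rw [CFC.norm_rpow _ (by positivity) (hX k)] at h1
  have h2 : ‖X k‖ ≤ 1 := by
    by_contra! hlt
    exact absurd h1 (not_le.2 (Real.one_lt_rpow hlt (by positivity)))
  rw [CStarRing.norm_self_mul_star, Unitization.norm_inr] at h2
  nlinarith [norm_nonneg (x k)]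

end Evaluation

/-! ### Homomorphisms out of an algebra generated by a tuple. -/

section Generation

variable {r : ℕ} {P B : Type u} [NonUnitalCStarAlgebra P] [NonUnitalCStarAlgebra B]

theorem exists_eval_of_mem_adjoin {x : Fin r → P} {y : Fin r → B} {g : P × B}
    (hg : g ∈ NonUnitalStarAlgebra.adjoin ℂ (Set.range fun k => (x k, y k))) :
    ∃ p : NCStarPoly r, NCStarPoly.eval x p = g.1 ∧ NCStarPoly.eval y p = g.2 := by
  have hg' : g ∈ (NonUnitalStarAlgebra.adjoin ℂ
    (Set.range fun k => (x k, y k))).toNonUnitalSubalgebra := hg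
  rw [NonUnitalStarAlgebra.adjoin_toNonUnitalSubalgebra] at hg'
  induction hg' using NonUnitalAlgebra.adjoin_induction with
  | mem a ha =>
    rcases ha with ⟨k, rfl⟩ | ha
    · exact ⟨FreeAlgebra.ι ℂ (Sum.inl k), by simp [NCStarPoly.eval]⟩
    · obtain ⟨k, hk⟩ := ha
      obtain rfl : a = star (x k, y k) := by
        change (x k, y k) = star a at hk
        rw [hk, star_star]
      exact ⟨FreeAlgebra.ι ℂ (Sum.inr k), by simp [NCStarPoly.eval]⟩
  | add a b _ _ iha ihb =>
    obtain ⟨p, hp1, hp2⟩ := iha ‹_›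
    obtain ⟨p', hp1', hp2'⟩ := ihb ‹_›
    exact ⟨p + p', by simp [*]⟩
  | zero => exact ⟨0, by simp⟩
  | mul a b _ _ iha ihb =>
    obtain ⟨p, hp1, hp2⟩ := iha ‹_›
    obtain ⟨p', hp1', hp2'⟩ := ihb ‹_›
    exact ⟨p * p', by simp [*]⟩
  | smul c a _ iha =>
    obtain ⟨p, hp1, hp2⟩ := iha ‹_›
    exact ⟨c • p, by simp [*]⟩

theorem NonUnitalStarAlgHom.continuous_of_cstarAlgebra (φ : P →⋆ₙₐ[ℂ] B) : Continuous φ :=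
  AddMonoidHomClass.continuous_of_bound φ 1 fun a => by
    simpa using NonUnitalStarAlgHom.norm_apply_le φ a

/-- The homomorphism is built as a graph: the closed `*`-subalgebra of `P × B` generated by the
pairs `(x k, y k)`. The norm bound makes its first projection injective, hence isometric with closed
range, and that range contains the generators. -/
theorem existsUnique_hom_of_norm_eval_le {x : Fin r → P}
    (hgen : ∀ S : NonUnitalStarSubalgebra ℂ P, IsClosed (S : Set P) → (∀ k, x k ∈ S) → S = ⊤)
    {y : Fin r → B} (h : ∀ p, ‖NCStarPoly.eval y p‖ ≤ ‖NCStarPoly.eval x p‖) :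
    ∃! φ : P →⋆ₙₐ[ℂ] B, ∀ k, φ (x k) = y k := by
  refine existsUnique_of_exists_of_unique ?_ fun φ ψ hφ hψ => ?_
  · set G := (NonUnitalStarAlgebra.adjoin ℂ
      (Set.range fun k => (x k, y k))).topologicalClosure with hG
    have hGc : IsClosed (G : Set (P × B)) :=
      NonUnitalStarSubalgebra.isClosed_topologicalClosure _
    have hmem : ∀ k, (x k, y k) ∈ G := fun k =>
      NonUnitalStarSubalgebra.le_topologicalClosure _
        (NonUnitalStarAlgebra.subset_adjoin ℂ _ ⟨k, rfl⟩)
    have hle : ∀ g ∈ G, ‖g.2‖ ≤ ‖g.1‖ := by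
      have hcl : IsClosed {g : P × B | ‖g.2‖ ≤ ‖g.1‖} :=
        isClosed_le (by fun_prop) (by fun_prop)
      intro g hg
      refine closure_minimal (fun g hg => ?_) hcl hg
      obtain ⟨p, hp1, hp2⟩ := exists_eval_of_mem_adjoin hg
      have := h p
      rwa [hp1, hp2, Unitization.norm_inr, Unitization.norm_inr] at this
    let π₁ : G →⋆ₙₐ[ℂ] P :=
      (NonUnitalStarAlgHom.fst ℂ P B).comp (NonUnitalStarSubalgebraClass.subtype G)
    let π₂ : G →⋆ₙₐ[ℂ] B :=
      (NonUnitalStarAlgHom.snd ℂ P B).comp (NonUnitalStarSubalgebraClass.subtype G)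
    have hinj : Function.Injective π₁ := by
      rw [injective_iff_map_eq_zero]
      rintro ⟨⟨a, b⟩, hab⟩ (h0 : a = 0)
      have := hle _ hab
      rw [h0, norm_zero, norm_le_zero_iff] at this
      subst h0
      exact Subtype.ext (Prod.ext rfl this)
    have hiso : Isometry π₁ := AddMonoidHomClass.isometry_of_norm π₁
      (NonUnitalStarAlgHom.norm_map π₁ hinj)
    have hsurj : Function.Surjective π₁ := by
      have := hgen (NonUnitalStarAlgHom.range π₁) (by
        rw [NonUnitalStarAlgHom.coe_range]
        exact hiso.isClosedEmbedding.isClosed_range) fun k => ⟨⟨_, hmem k⟩, rfl⟩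
      intro a
      have ha : a ∈ NonUnitalStarAlgHom.range π₁ := this ▸ NonUnitalStarAlgebra.mem_top
      exact ha
    let e : G ≃⋆ₐ[ℂ] P := StarAlgEquiv.ofBijective π₁ ⟨hinj, hsurj⟩
    refine ⟨π₂.comp (e.symm : P →⋆ₙₐ[ℂ] G), fun k => ?_⟩
    have : e.symm (x k) = ⟨_, hmem k⟩ := by
      rw [StarAlgEquiv.symm_apply_eq]
      rfl
    change π₂ (e.symm (x k)) = y k
    rw [this]
    rfl
  · have := hgen (NonUnitalStarAlgHom.equalizer φ ψ)
      (isClosed_eq φ.continuous_of_cstarAlgebra ψ.continuous_of_cstarAlgebra)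
      fun k => (hφ k).trans (hψ k).symm
    ext a
    have ha : a ∈ NonUnitalStarAlgHom.equalizer φ ψ := this ▸ NonUnitalStarAlgebra.mem_top
    exact ha

end Generation

/-! ### The universal C*-algebra. -/

section Existence

open scoped ENNReal

/-- Evaluation at a coordinate of the `ℓ^∞`-product of C*-algebras. -/
noncomputable def lpInftyEval {ι : Type*} (B : ι → Type*) [∀ i, NonUnitalCStarAlgebra (B i)]
    (i : ι) : lp B ∞ →⋆ₙₐ[ℂ] B i where
  toFun f := f i
  map_smul' _ _ := rfl
  map_zero' := rfl
  map_add' _ _ := rfl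
  map_mul' _ _ := rfl
  map_star' _ := rfl

/-- A tuple in some C*-algebra that satisfies the relations. -/
structure BallRepresentation {r J : ℕ} (q : ℝ) (p : Fin J → NCStarPoly r) (C : Fin J → ℝ) where
  carrier : Type u
  [inst : NonUnitalCStarAlgebra carrier]
  tuple : Fin r → carrier
  rel : NCBallRelations q p C carrier tuple

attribute [instance] BallRepresentation.inst

variable {r J : ℕ} {q : ℝ} {p : Fin J → NCStarPoly r} {C : Fin J → ℝ} {d : Fin J → ℕ}

/-- The seminorm on polynomials induced by a representation. -/
noncomputable def BallRepresentation.seminorm (R : BallRepresentation.{u} q p C) :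
    NCStarPoly r → ℝ := fun f => ‖NCStarPoly.eval R.tuple f‖

/-- A choice of one representation for every induced seminorm. -/
noncomputable def BallRepresentation.choice
    (i : Set.range (BallRepresentation.seminorm.{u} (q := q) (p := p) (C := C))) :
    BallRepresentation.{u} q p C :=
  i.2.choose

theorem exists_isUniversalCStarAlgebra (hq : 0 < q) (hd : ∀ j, 1 ≤ d j)
    (hp : ∀ j, (p j).IsHomogeneous (d j)) (hC : ∀ j, 0 < C j) :
    ∃ (P : Type u) (_ : NonUnitalCStarAlgebra P) (x : Fin r → P),
      IsUniversalCStarAlgebra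
        (fun A [NonUnitalCStarAlgebra A] => NCBallRelations q p C A) P x := by
  -- Representations are too many to index a product in `Type u`, but their seminorms on `NCStarPoly
  -- r` form a small set, and the seminorm is all that the universal property needs.
  let I := Set.range (BallRepresentation.seminorm.{u} (q := q) (p := p) (C := C))
  let F : I → Type u := fun i => (BallRepresentation.choice i).carrier
  let x₀ : Fin r → lp F ∞ := fun k => ⟨fun i => (BallRepresentation.choice i).tuple k,
    memℓp_infty ⟨1, by
      rintro _ ⟨i, rfl⟩
      exact (BallRepresentation.choice i).rel.norm_le_one hq k⟩⟩
  have hx₀ : NCBallRelations q p C (lp F ∞) x₀ :=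
    NCBallRelations.of_jointly_isometric (lpInftyEval F)
      (fun a M hM ha => lp.norm_le_of_forall_le hM ha) hq hd hp hC
      fun i => (BallRepresentation.choice i).rel
  let P := (NonUnitalStarAlgebra.adjoin ℂ (Set.range x₀)).topologicalClosure
  have hPc : IsClosed (P : Set (lp F ∞)) := NonUnitalStarSubalgebra.isClosed_topologicalClosure _
  let x : Fin r → P := fun k => ⟨x₀ k, NonUnitalStarSubalgebra.le_topologicalClosure _
        (NonUnitalStarAlgebra.subset_adjoin ℂ _ ⟨k, rfl⟩)⟩
  let inc : P →⋆ₙₐ[ℂ] lp F ∞ := NonUnitalStarSubalgebraClass.subtype P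
  refine ⟨P, inferInstance, x, ?_, fun B _ y hy => existsUnique_hom_of_norm_eval_le ?_ ?_⟩
  · exact NCBallRelations.of_jointly_isometric (fun _ : Unit => inc) (fun a M _ ha => ha ()) hq hd hp hC
      fun _ => hx₀
  · intro S hS hxS
    have hle : P ≤ S.map inc := by
      refine NonUnitalStarSubalgebra.topologicalClosure_minimal _
        (NonUnitalStarAlgebra.adjoin_le ?_) ?_
      · rintro _ ⟨k, rfl⟩
        exact ⟨x k, hxS k, rfl⟩
      · exact hPc.isClosedEmbedding_subtypeVal.isClosedMap _ hS
    refine NonUnitalStarAlgebra.eq_top_iff.2 fun a => ?_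
    obtain ⟨b, hb, hba⟩ := hle a.2
    exact (Subtype.ext hba : b = a) ▸ hb
  · intro f
    let R : BallRepresentation.{u} q p C := ⟨B, y, hy⟩
    let i : I := ⟨R.seminorm, R, rfl⟩
    have h1 : ‖NCStarPoly.eval (BallRepresentation.choice i).tuple f‖ = ‖NCStarPoly.eval y f‖ :=
      congrFun i.2.choose_spec f
    rw [← h1]
    have h2 := NCStarPoly.starMap_eval ((lpInftyEval F i).comp inc) x f
    have h3 := NonUnitalStarAlgHom.norm_apply_le
      (Unitization.starMap ((lpInftyEval F i).comp inc)) (NCStarPoly.eval x f)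
    rw [h2] at h3
    exact h3

end Existence

/-- The unital lifting result is applied to `Unitization.starMap ρ`. That map preserves scalar
parts, so a lift of elements of `D` lies in `B`. -/
theorem NCBallRelations.exists_lift {r J : ℕ} {q : ℝ} (hq : 2 < q) {p : Fin J → NCStarPoly r}
    {d : Fin J → ℕ} (hd : ∀ j, 1 ≤ d j) (hp : ∀ j, (p j).IsHomogeneous (d j)) {C : Fin J → ℝ}
    (hC : ∀ j, 0 < C j) {B D : Type u} [NonUnitalCStarAlgebra B] [NonUnitalCStarAlgebra D]
    (ρ : B →⋆ₙₐ[ℂ] D) (hρ : Function.Surjective ρ) {y : Fin r → D}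
    (hy : NCBallRelations q p C D y) :
    ∃ z : Fin r → B, (∀ k, ρ (z k) = y k) ∧ NCBallRelations q p C B z := by
  let _ : PartialOrder (Unitization ℂ B) := CStarAlgebra.spectralOrder _
  let _ : StarOrderedRing (Unitization ℂ B) := CStarAlgebra.spectralOrderedRing _
  have hq0 : 0 < q := by linarith
  choose x hx using fun k => hρ (y k)
  obtain ⟨w, hw, hrel⟩ := RelaxedRelations.exists_lift (ρ := Unitization.starMap ρ)
    (x := fun k => (x k : Unitization ℂ B)) (by linarith : (1 : ℝ) ≤ q / 2) hd hp hC
    ((ncBallRelations_iff_relaxedRelations hq0).1 hy)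
    fun k => by rw [Unitization.starMap_inr, hx]
  have hfst : ∀ k, (w k).fst = 0 := fun k => by
    have := congrArg (fun a => a.fst) (hw k)
    rw [← Unitization.inl_fst_add_inr_snd_eq (w k), map_add, Unitization.starMap_inl,
      Unitization.starMap_inr] at this
    simpa [Unitization.algebraMap_eq_inl] using this
  have hwk : w = fun k => ((w k).snd : Unitization ℂ B) := funext fun k => by
    ext
    · simpa using hfst k
    · simp
  refine ⟨fun k => (w k).snd, fun k => ?_, ?_⟩
  · have := hw k
    rw [hwk, Unitization.starMap_inr] at this
    exact Unitization.inr_injective this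
  · rw [ncBallRelations_iff_relaxedRelations hq0, ← hwk]
    exact hrel

theorem theorem5p5 (r J : ℕ) (q : ℝ) (hq : 2 < q)
    (p : Fin J → NCStarPoly r) (d : Fin J → ℕ) (hd : ∀ j, 1 ≤ d j)
    (hp : ∀ j, (p j).IsHomogeneous (d j))
    (C : Fin J → ℝ) (hC : ∀ j, 0 < C j) :
    (∃ (P : Type u) (_ : NonUnitalCStarAlgebra P) (x : Fin r → P),
      IsUniversalCStarAlgebra (fun A [NonUnitalCStarAlgebra A] => NCBallRelations q p C A) P x) ∧
    ∀ (P : Type u) [NonUnitalCStarAlgebra P] (x : Fin r → P),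
      IsUniversalCStarAlgebra (fun A [NonUnitalCStarAlgebra A] => NCBallRelations q p C A) P x →
        IsProjectiveCStarAlgebra P := by
  refine ⟨exists_isUniversalCStarAlgebra (by linarith) hd hp hC, ?_⟩
  intro P _ x hP B D _ _ ρ hρ φ
  have hy := hP.rel.map (by linarith) φ
  obtain ⟨z, hz, hrel⟩ := NCBallRelations.exists_lift hq hd hp hC ρ hρ hy
  obtain ⟨ψ, hψ, -⟩ := hP.existsUnique_hom B z hrel
  -- Both `ρ ∘ ψ` and `φ` send the generators to the tuple `φ (x k)`, so uniqueness identifies them.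
  refine ⟨ψ, (hP.existsUnique_hom D _ hy).unique (fun k => ?_) fun k => rfl⟩
  change ρ (ψ (x k)) = φ (x k)
  rw [hψ, hz]
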